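/- Let $n\ge 4$. A second-order element is a pair $(v,w)\in\mathbb C^2$ (thought of as $(u',u'')$). Point transformations of the plane induce on second-order elements the eight-parameter group of transformations $$V=\frac{av+b}{cv+d},\qquad W=\frac{\lambda+\mu v+\nu v^2+\xi v^3+(ad-bc)w}{(cv+d)^3},\qquad a,b,c,d,\lambda,\mu,\nu,\xi\in\mathbb C,\ ad-bc\neq0,$$ which acts jointly on $n$-tuples $(v_1,w_1),\dots,(v_n,w_n)$ (where all $cv_i+d\ne0$). Its infinitesimal generators are $$\sum_k\partial_{v_k},\ \sum_k\partial_{w_k},\ \sum_k v_k\partial_{v_k},\ \sum_k w_k\partial_{w_k},\ \sum_k(v_k^2\partial_{v_k}+3v_kw_k\partial_{w_k}),\ \sum_k v_k\partial_{w_k},\ \sum_k v_k^2\partial_{w_k},\ \sum_k v_k^3\partial_{w_k}.$$ Put $$\xi_i=\frac{v_i-v_1}{v_2-v_1},\quad \eta_i=\frac{w_i-w_1}{w_2-w_1},\quad r_j=\frac{\xi_3(\xi_j-1)}{\xi_j(\xi_3-1)},\quad s_i=\frac{\eta_i}{\xi_i^3},\quad \sigma_i=\frac{s_i-1}{s_3-1},\quad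 \tau_i=\frac{\sigma_i-r_i}{\sigma_4-r_4},$$ $$\Omega_l=\frac{(r_4^2-r_4)\tau_l-(r_l^2-r_l)}{(r_4^2-r_4)\tau_5-(r_5^2-r_5)},$$ and consider the system $I=(r_4,\dots,r_n,\Omega_6,\dots,\Omega_n)$, consisting of $n-3$ functions $r_j$ and, when $n\ge6$, $n-5$ functions $\Omega_l$ (none for $n=4,5$); for $n\ge5$ these are $2n-8$ functions, for $n=4$ there is just $r_4$. Call an $n$-tuple of elements generic if the $v_i$ are pairwise distinct; if, for $n\ge5$, the first five elements do not lie on a common curve $w=A+Bv+Cv^2+Dv^3$; and if, for $n\ge6$, no denominator in the above formulas for the $\Omega_l$ vanishes. Then: 1. For generic tuples, $r_j=\dfrac{(v_3-v_1)(v_j-v_2)}{(v_3-v_2)(v_j-v_1)}$ is a cross-ratio of the directions $v_1,v_2,v_3,v_j$. The $r_j$ and $\Omega_l$ are absolute invariants of the joint action on the set of generic tuples, and they are functionally independent: their differentials are linearly independent at every generic tuple. 2. (Functional completeness.) Let $D$ be any set of generic tuples and $f$ a complex-valued function on $D$. Then $f$ is invariant under the group (that is, $f(g\cdot p)=f(p)$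 whenever $p\in D$, $g\cdot p$ is defined and $g\cdot p\in D$) if and only if $f=F\circ I$ on $D$ for some function $F$. Moreover, a holomorphic function $f$ on an open set $U$ of generic tuples is annihilated on $U$ by the eight infinitesimal generators if and only if every point of $U$ has an open neighbourhood in $U$ on which $f=F\circ I$ for a function $F$ that is holomorphic on an open set containing the image of this neighbourhood under $I$. 3. A rational function $\varphi\in\mathbb C(v_1,w_1,\dots,v_n,w_n)$ is an absolute invariant (that is, $\varphi(V_1,W_1,\dots,V_n,W_n)=\varphi(v_1,w_1,\dots,v_n,w_n)$ for every element of the group) if and only if it is a rational function of the invariants $r_4,\dots,r_n,\Omega_6,\dots,\Omega_n$, i.e. $\varphi\in\mathbb C(r_4,\dots,r_n,\Omega_6,\dots,\Omega_n)$. -/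

import Mathlib

namespace PointInvariants

/-- The parameters `(a, b, c, d, λ, μ, ν, ξ)`, `ad - bc ≠ 0`, of the eight-parameter group induced
by the point transformations of the plane on the second-order elements `(v, w) = (u', u'')`. -/
structure PointParam where
  a : ℂ
  b : ℂ
  c : ℂ
  d : ℂ
  lam : ℂ
  mu : ℂ
  nu : ℂ
  xi : ℂ
  det_ne_zero : a * d - b * c ≠ 0

section Formulas

variable {K : Type*} [Field K] {n : ℕ}

section Action

variable [Algebra ℂ K]

/-- The denominator `c v + d`. -/
def PointParam.den (g : PointParam) (v : K) : K :=
  algebraMap ℂ K g.c * v + algebraMap ℂ K g.d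

/-- `V = (a v + b) / (c v + d)`. -/
def PointParam.actV (g : PointParam) (v : K) : K :=
  (algebraMap ℂ K g.a * v + algebraMap ℂ K g.b) / g.den v

/-- `W = (λ + μ v + ν v ^ 2 + ξ v ^ 3 + (a d - b c) w) / (c v + d) ^ 3`. -/
def PointParam.actW (g : PointParam) (v w : K) : K :=
  (algebraMap ℂ K g.lam + algebraMap ℂ K g.mu * v + algebraMap ℂ K g.nu * v ^ 2
    + algebraMap ℂ K g.xi * v ^ 3 + algebraMap ℂ K (g.a * g.d - g.b * g.c) * w) / g.den v ^ 3

/-- The joint action on `n` elements, a tuple of elements being a pair `(v, w)` of `n`-tuples.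
It is defined at `(v, w)` when `c v_i + d ≠ 0` for all `i`. -/
def PointParam.act (g : PointParam) (p : (Fin n → K) × (Fin n → K)) :
    (Fin n → K) × (Fin n → K) :=
  (fun i => g.actV (p.1 i), fun i => g.actW (p.1 i) (p.2 i))

/-- The joint action of `g` is defined at `p`. -/
def PointParam.DefinedAt (g : PointParam) (p : (Fin n → K) × (Fin n → K)) : Prop :=
  ∀ i, g.den (p.1 i) ≠ 0

end Action

/-- The `k`-th entry of an `n`-tuple, counted from `1` (used only for `1 ≤ k ≤ n`). -/
def entry (v : Fin n → K) (k : ℕ) : K :=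
  if h : 1 ≤ k ∧ k ≤ n then v ⟨k - 1, by omega⟩ else 0

/-- `(x_i - x_1) / (x_2 - x_1)`: this is `ξ_i` for `x = v` and `η_i` for `x = w`. -/
def diffRatio (x : Fin n → K) (i : ℕ) : K :=
  (entry x i - entry x 1) / (entry x 2 - entry x 1)

/-- `r_j = ξ_3 (ξ_j - 1) / (ξ_j (ξ_3 - 1))`. -/
def r (v : Fin n → K) (j : ℕ) : K :=
  (diffRatio v 3 * (diffRatio v j - 1)) / (diffRatio v j * (diffRatio v 3 - 1))

/-- `s_i = η_i / ξ_i ^ 3`. -/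
def s (v w : Fin n → K) (i : ℕ) : K := diffRatio w i / diffRatio v i ^ 3

/-- `σ_i = (s_i - 1) / (s_3 - 1)`. -/
def sigma (v w : Fin n → K) (i : ℕ) : K := (s v w i - 1) / (s v w 3 - 1)

/-- `τ_i = (σ_i - r_i) / (σ_4 - r_4)`. -/
def tau (v w : Fin n → K) (i : ℕ) : K :=
  (sigma v w i - r v i) / (sigma v w 4 - r v 4)

/-- `(r_4 ^ 2 - r_4) τ_l - (r_l ^ 2 - r_l)`. -/
def omegaNum (v w : Fin n → K) (l : ℕ) : K :=
  (r v 4 ^ 2 - r v 4) * tau v w l - (r v l ^ 2 - r v l)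

/-- `Ω_l`, the quotient of the previous expression for `l` by the one for `5`. -/
def Omega (v w : Fin n → K) (l : ℕ) : K := omegaNum v w l / omegaNum v w 5

/-- The index set of the fundamental invariants: `r_4, …, r_n` and `Ω_6, …, Ω_n`
(no `Ω` for `n = 4, 5`). -/
abbrev InvIndex (n : ℕ) : Type := Fin (n - 3) ⊕ Fin (n - 5)

/-- The fundamental invariants `(r_4, …, r_n, Ω_6, …, Ω_n)` of `n` elements. -/
def fundInv (p : (Fin n → K) × (Fin n → K)) : InvIndex n → K
  | Sum.inl j => r p.1 (j + 4)
  | Sum.inr l => Omega p.1 p.2 (l + 6)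

end Formulas

/-- General position of `n` elements: the `v_i` are pairwise distinct; if `n ≥ 5`, the first five
elements do not lie on a common curve `w = A + B v + C v ^ 2 + D v ^ 3`; and if `n ≥ 6`,
the denominators in the formulas for the `Ω_l` do not vanish. -/
def GenericElements {n : ℕ} (p : (Fin n → ℂ) × (Fin n → ℂ)) : Prop :=
  Function.Injective p.1 ∧
  (5 ≤ n → ¬ ∃ A B C D : ℂ, ∀ k : ℕ, 1 ≤ k → k ≤ 5 →
    entry p.2 k = A + B * entry p.1 k + C * entry p.1 k ^ 2 + D * entry p.1 k ^ 3) ∧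
  (6 ≤ n → entry p.2 2 ≠ entry p.2 1 ∧ s p.1 p.2 3 ≠ 1 ∧ sigma p.1 p.2 4 ≠ r p.1 4 ∧
    omegaNum p.1 p.2 5 ≠ 0)

/-- `f` is invariant on `D` under the joint action of the group. -/
def IsInvariantOn {n : ℕ} (f : (Fin n → ℂ) × (Fin n → ℂ) → ℂ)
    (D : Set ((Fin n → ℂ) × (Fin n → ℂ))) : Prop :=
  ∀ (g : PointParam), ∀ p ∈ D, g.DefinedAt p → g.act p ∈ D → f (g.act p) = f p

/-- `∂f/∂v_k`. -/
noncomputable def partialV {n : ℕ} (f : (Fin n → ℂ) × (Fin n → ℂ) → ℂ) (k : Fin n)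
    (p : (Fin n → ℂ) × (Fin n → ℂ)) : ℂ :=
  fderiv ℂ f p (Pi.single k 1, 0)

/-- `∂f/∂w_k`. -/
noncomputable def partialW {n : ℕ} (f : (Fin n → ℂ) × (Fin n → ℂ) → ℂ) (k : Fin n)
    (p : (Fin n → ℂ) × (Fin n → ℂ)) : ℂ :=
  fderiv ℂ f p (0, Pi.single k 1)

/-- `f` is annihilated at `p` by the eight infinitesimal generators of the joint action. -/
def IsInfinitesimallyInvariantAt {n : ℕ} (f : (Fin n → ℂ) × (Fin n → ℂ) → ℂ)
    (p : (Fin n → ℂ) × (Fin n → ℂ)) : Prop :=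
  ∑ k, partialV f k p = 0 ∧
  ∑ k, partialW f k p = 0 ∧
  ∑ k, p.1 k * partialV f k p = 0 ∧
  ∑ k, p.2 k * partialW f k p = 0 ∧
  ∑ k, (p.1 k ^ 2 * partialV f k p + 3 * p.1 k * p.2 k * partialW f k p) = 0 ∧
  ∑ k, p.1 k * partialW f k p = 0 ∧
  ∑ k, p.1 k ^ 2 * partialW f k p = 0 ∧
  ∑ k, p.1 k ^ 3 * partialW f k p = 0

/-- Complex polynomials in `v_1, …, v_n` (left summand) and `w_1, …, w_n` (right summand). -/
abbrev PolyVW (n : ℕ) : Type := MvPolynomial (Fin n ⊕ Fin n) ℂ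

/-- The field `ℂ(v_1, w_1, …, v_n, w_n)`. -/
abbrev RatVW (n : ℕ) : Type := FractionRing (PolyVW n)

/-- The tuple of the indeterminates `v_i`, `w_i`. -/
noncomputable def genericPoint (n : ℕ) : (Fin n → RatVW n) × (Fin n → RatVW n) :=
  (fun i => algebraMap (PolyVW n) (RatVW n) (MvPolynomial.X (Sum.inl i)),
   fun i => algebraMap (PolyVW n) (RatVW n) (MvPolynomial.X (Sum.inr i)))

/-- The substitution `P ↦ P(V_1, W_1, …, V_n, W_n)` of the transformed elements in a polynomial. -/
noncomputable def PointParam.subst {n : ℕ} (g : PointParam) : PolyVW n →ₐ[ℂ] RatVW n :=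
  MvPolynomial.aeval
    (Sum.elim (g.act (genericPoint n)).1 (g.act (genericPoint n)).2)

/-- The rational function `φ` is an absolute invariant: `φ(V, W) = φ(v, w)` for every element of
the group. Written as `φ = N / Q`, this says `N(V, W) = φ(v, w) * Q(V, W)`; the substitution is
injective, so that `Q(V, W) ≠ 0` when `Q ≠ 0`. -/
def IsRationalInvariant {n : ℕ} (φ : RatVW n) : Prop :=
  ∀ (g : PointParam) (N Q : PolyVW n),
    φ * algebraMap (PolyVW n) (RatVW n) Q = algebraMap (PolyVW n) (RatVW n) N →
    φ * g.subst Q = g.subst N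

end PointInvariants

/-! The group acts on the directions by Möbius maps, and it carries cubics $w=A+Bv+Cv^2+Dv^3$ to
cubics. Hence the deviation of the $l$-th element from the cubic through the first four, divided by
$(v_l-v_1)^3$ (`excess`), is multiplied by a factor independent of $l$ (`excess_act`). The
definition of $\Omega_l$ conceals the quotient of two such deviations (`omegaNum_eq`, `Omega_eq`),
and the $r_j$ are cross-ratios (`r_eq_crossRatio`); this gives invariance.

Conversely, equal cross-ratios provide a Möbius map matching the directions; the remaining freedom
is to scale $w$ and to add a cubic, which matches the second coordinates exactly when the ratios of
the deviations agree. So generic tuples with equal invariants lie in one orbit (`exists_act_eq`),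
and this settles invariant functions on arbitrary sets.

The other parts rest on an explicit rational section: `reconstruct q y` keeps three directions and
five second coordinates of `q` and computes the rest from the values `y`. It inverts `fundInv`
(`reconstruct_fundInv`, `fundInv_reconstruct`), so the differential of `fundInv` is surjective,
whence independence. The kernel of that differential is spanned by the generators
(`exists_generatorField_eq`), so an annihilated function is constant when the base tuple of the
section moves with the invariants held fixed; therefore it is locally a holomorphic function of the
invariants.

For a rational invariant $\varphi=N/Q$, insert the section over a fixed complex tuple: the section
has coordinates in the field generated by the invariants and meets the same orbits, so $\varphi$
lies in this field. Identities in the function field are compared with pointwise ones through germs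
along an ultrafilter that avoids all hypersurfaces (`Represents.eq_iff`). -/

open Filter Topology

namespace PointInvariants

/-! ### Cubic interpolation through four points. -/

section Interpolation

variable {K : Type*} [Field K]

/-- The value at `x` of the cubic through `(a, p)`, `(b, q)`, `(c, r)`, `(d, s)`. -/
def lagrangeCubic (a b c d p q r s x : K) : K :=
  p / ((a - b) * (a - c) * (a - d)) * ((x - b) * (x - c) * (x - d))
    + q / ((b - a) * (b - c) * (b - d)) * ((x - a) * (x - c) * (x - d))
    + r / ((c - a) * (c - b) * (c - d)) * ((x - a) * (x - b) * (x - d))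
    + s / ((d - a) * (d - b) * (d - c)) * ((x - a) * (x - b) * (x - c))

theorem exists_lagrangeCubic_eq (a b c d p q r s : K) :
    ∃ A B C D : K, ∀ x, lagrangeCubic a b c d p q r s x = A + B * x + C * x ^ 2 + D * x ^ 3 := by
  unfold lagrangeCubic
  generalize p / ((a - b) * (a - c) * (a - d)) = p'
  generalize q / ((b - a) * (b - c) * (b - d)) = q'
  generalize r / ((c - a) * (c - b) * (c - d)) = r'
  generalize s / ((d - a) * (d - b) * (d - c)) = s'
  refine ⟨-(p' * b * c * d + q' * a * c * d + r' * a * b * d + s' * a * b * c),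
    p' * (b * c + b * d + c * d) + q' * (a * c + a * d + c * d) + r' * (a * b + a * d + b * d)
      + s' * (a * b + a * c + b * c),
    -(p' * (b + c + d) + q' * (a + c + d) + r' * (a + b + d) + s' * (a + b + c)),
    p' + q' + r' + s', fun x => by ring⟩

variable {a b c d : K} (hab : a ≠ b) (hac : a ≠ c) (had : a ≠ d) (hbc : b ≠ c) (hbd : b ≠ d)
  (hcd : c ≠ d)
include hab hac had hbc hbd hcd

theorem lagrangeCubic_nodes (p q r s : K) :
    lagrangeCubic a b c d p q r s a = p ∧ lagrangeCubic a b c d p q r s b = q ∧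
      lagrangeCubic a b c d p q r s c = r ∧ lagrangeCubic a b c d p q r s d = s := by
  have h1 := sub_ne_zero.2 hab
  have h2 := sub_ne_zero.2 hac
  have h3 := sub_ne_zero.2 had
  have h4 := sub_ne_zero.2 hbc
  have h5 := sub_ne_zero.2 hbd
  have h6 := sub_ne_zero.2 hcd
  have h1' := sub_ne_zero.2 hab.symm
  have h2' := sub_ne_zero.2 hac.symm
  have h3' := sub_ne_zero.2 had.symm
  have h4' := sub_ne_zero.2 hbc.symm
  have h5' := sub_ne_zero.2 hbd.symm
  have h6' := sub_ne_zero.2 hcd.symm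
  unfold lagrangeCubic
  refine ⟨?_, ?_, ?_, ?_⟩ <;> simp <;> field_simp

/-- A cubic vanishing at four points vanishes. -/
theorem cubic_eq_zero {A B C D : K} (ha : A + B * a + C * a ^ 2 + D * a ^ 3 = 0)
    (hb : A + B * b + C * b ^ 2 + D * b ^ 3 = 0) (hc : A + B * c + C * c ^ 2 + D * c ^ 3 = 0)
    (hd : A + B * d + C * d ^ 2 + D * d ^ 3 = 0) : A = 0 ∧ B = 0 ∧ C = 0 ∧ D = 0 := by
  have h1 := sub_ne_zero.2 hab
  have h2 := sub_ne_zero.2 hac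
  have h3 := sub_ne_zero.2 had
  have h4 := sub_ne_zero.2 hbc
  have h5 := sub_ne_zero.2 hbd
  have h6 := sub_ne_zero.2 hcd
  -- Successive divided differences lower the degree until only `D` is left.
  have e1 : B + C * (a + b) + D * (a ^ 2 + a * b + b ^ 2) = 0 :=
    mul_left_cancel₀ h1 (by linear_combination ha - hb)
  have e2 : B + C * (a + c) + D * (a ^ 2 + a * c + c ^ 2) = 0 :=
    mul_left_cancel₀ h2 (by linear_combination ha - hc)
  have e3 : B + C * (a + d) + D * (a ^ 2 + a * d + d ^ 2) = 0 :=
    mul_left_cancel₀ h3 (by linear_combination ha - hd)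
  have f1 : C + D * (a + b + c) = 0 := mul_left_cancel₀ h4 (by linear_combination e1 - e2)
  have f2 : C + D * (a + b + d) = 0 := mul_left_cancel₀ h5 (by linear_combination e1 - e3)
  have hD : D = 0 := mul_left_cancel₀ h6 (by linear_combination f1 - f2)
  subst hD
  have hC : C = 0 := by linear_combination f1
  subst hC
  have hB : B = 0 := by linear_combination e1
  subst hB
  exact ⟨by linear_combination ha, rfl, rfl, rfl⟩

theorem lagrangeCubic_cubic (A B C D x : K) :
    lagrangeCubic a b c d (A + B * a + C * a ^ 2 + D * a ^ 3) (A + B * b + C * b ^ 2 + D * b ^ 3)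
      (A + B * c + C * c ^ 2 + D * c ^ 3) (A + B * d + C * d ^ 2 + D * d ^ 3) x
      = A + B * x + C * x ^ 2 + D * x ^ 3 := by
  obtain ⟨h1, h2, h3, h4⟩ := lagrangeCubic_nodes hab hac had hbc hbd hcd
    (A + B * a + C * a ^ 2 + D * a ^ 3) (A + B * b + C * b ^ 2 + D * b ^ 3)
    (A + B * c + C * c ^ 2 + D * c ^ 3) (A + B * d + C * d ^ 2 + D * d ^ 3)
  obtain ⟨A', B', C', D', h⟩ := exists_lagrangeCubic_eq a b c d
    (A + B * a + C * a ^ 2 + D * a ^ 3) (A + B * b + C * b ^ 2 + D * b ^ 3)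
    (A + B * c + C * c ^ 2 + D * c ^ 3) (A + B * d + C * d ^ 2 + D * d ^ 3)
  rw [h] at h1 h2 h3 h4 ⊢
  obtain ⟨g1, g2, g3, g4⟩ := cubic_eq_zero (A := A' - A) (B := B' - B) (C := C' - C)
    (D := D' - D) hab hac had hbc hbd hcd (by linear_combination h1) (by linear_combination h2)
    (by linear_combination h3) (by linear_combination h4)
  rw [sub_eq_zero.1 g1, sub_eq_zero.1 g2, sub_eq_zero.1 g3, sub_eq_zero.1 g4]

end Interpolation

/-! ### The invariants as cross-ratios and quotients of deviations, over any field. -/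

section Field

variable {K : Type*} [Field K] {n : ℕ}

theorem entry_of_le (x : Fin n → K) {k : ℕ} (h1 : 1 ≤ k) (h2 : k ≤ n) :
    entry x k = x ⟨k - 1, by omega⟩ := dif_pos ⟨h1, h2⟩

theorem entry_succ (x : Fin n → K) (i : Fin n) : entry x (i + 1) = x i :=
  dif_pos ⟨by omega, i.2⟩

theorem entry_ne {v : Fin n → K} (hv : Function.Injective v) {i j : ℕ} (hi : 1 ≤ i) (hi' : i ≤ n)
    (hj : 1 ≤ j) (hj' : j ≤ n) (hij : i ≠ j) : entry v i ≠ entry v j := by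
  rw [entry_of_le _ hi hi', entry_of_le _ hj hj']
  intro h
  have := Fin.mk.inj_iff.1 (hv h)
  omega

/-- The value at `x` of the cubic through the first four elements. -/
def cubicInterp (v w : Fin n → K) (x : K) : K :=
  lagrangeCubic (entry v 1) (entry v 2) (entry v 3) (entry v 4)
    (entry w 1) (entry w 2) (entry w 3) (entry w 4) x

/-- The weighted deviation of the `l`-th element from the cubic through the first four. -/
def excess (v w : Fin n → K) (l : ℕ) : K :=
  (entry w l - cubicInterp v w (entry v l)) / (entry v l - entry v 1) ^ 3

theorem cubicInterp_nodes (hn : 4 ≤ n) {v : Fin n → K} (hv : Function.Injective v)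
    (w : Fin n → K) {k : ℕ} (h1 : 1 ≤ k) (h4 : k ≤ 4) :
    cubicInterp v w (entry v k) = entry w k := by
  obtain ⟨e1, e2, e3, e4⟩ := lagrangeCubic_nodes
    (entry_ne hv (i := 1) (j := 2) (by omega) (by omega) (by omega) (by omega) (by omega))
    (entry_ne hv (i := 1) (j := 3) (by omega) (by omega) (by omega) (by omega) (by omega))
    (entry_ne hv (i := 1) (j := 4) (by omega) (by omega) (by omega) (by omega) (by omega))
    (entry_ne hv (i := 2) (j := 3) (by omega) (by omega) (by omega) (by omega) (by omega))
    (entry_ne hv (i := 2) (j := 4) (by omega) (by omega) (by omega) (by omega) (by omega))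
    (entry_ne hv (i := 3) (j := 4) (by omega) (by omega) (by omega) (by omega) (by omega))
    (entry w 1) (entry w 2) (entry w 3) (entry w 4)
  interval_cases k
  exacts [e1, e2, e3, e4]

theorem cubicInterp_eq_cubic (hn : 4 ≤ n) {v w : Fin n → K} (hv : Function.Injective v)
    {A B C D : K} (h : ∀ k, 1 ≤ k → k ≤ 4 →
      entry w k = A + B * entry v k + C * entry v k ^ 2 + D * entry v k ^ 3) (x : K) :
    cubicInterp v w x = A + B * x + C * x ^ 2 + D * x ^ 3 := by
  unfold cubicInterp
  rw [h 1 (by omega) (by omega), h 2 (by omega) (by omega), h 3 (by omega) (by omega),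
    h 4 (by omega) (by omega)]
  exact lagrangeCubic_cubic
    (entry_ne hv (i := 1) (j := 2) (by omega) (by omega) (by omega) (by omega) (by omega))
    (entry_ne hv (i := 1) (j := 3) (by omega) (by omega) (by omega) (by omega) (by omega))
    (entry_ne hv (i := 1) (j := 4) (by omega) (by omega) (by omega) (by omega) (by omega))
    (entry_ne hv (i := 2) (j := 3) (by omega) (by omega) (by omega) (by omega) (by omega))
    (entry_ne hv (i := 2) (j := 4) (by omega) (by omega) (by omega) (by omega) (by omega))
    (entry_ne hv (i := 3) (j := 4) (by omega) (by omega) (by omega) (by omega) (by omega))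
    A B C D x

theorem r_eq_crossRatio (hn : 4 ≤ n) {v : Fin n → K} (hv : Function.Injective v) {j : ℕ}
    (hj : 4 ≤ j) (hjn : j ≤ n) :
    r v j = ((entry v 3 - entry v 1) * (entry v j - entry v 2)) /
      ((entry v 3 - entry v 2) * (entry v j - entry v 1)) := by
  have h1 := sub_ne_zero.2
    (entry_ne hv (i := 2) (j := 1) (by omega) (by omega) (by omega) (by omega) (by omega))
  have h2 := sub_ne_zero.2
    (entry_ne hv (i := 3) (j := 2) (by omega) (by omega) (by omega) (by omega) (by omega))
  have h3 := sub_ne_zero.2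
    (entry_ne hv (i := j) (j := 1) (by omega) (by omega) (by omega) (by omega) (by omega))
  have h4 : (entry v 3 - entry v 1) / (entry v 2 - entry v 1) - 1 ≠ 0 := by
    rw [div_sub_one h1]
    exact div_ne_zero (by simpa using h2) h1
  unfold r diffRatio
  rw [div_eq_div_iff (mul_ne_zero (div_ne_zero h3 h1) h4) (mul_ne_zero h2 h3)]
  field_simp
  ring

/-- Put $t_k=v_k-v_1$. On a cubic, $(w_k-w_1)/t_k^3$ is a quadratic polynomial in $1/t_k$, and $r_k$
is the affine coordinate of $1/t_k$ that is $0$ for $k=2$ and $1$ for $k=3$. Passing from $s$ to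
$\sigma-r$ removes the constant and linear terms, so up to a common factor $\sigma_k-r_k$ is
$c(r_k^2-r_k)$ plus the deviation. The deviation is zero for $k=4$, which determines $c$;
eliminating the quadratic term leaves the deviation alone. -/
theorem omegaNum_eq (hn : 4 ≤ n) {v w : Fin n → K} (hv : Function.Injective v)
    (hw : entry w 2 ≠ entry w 1) (hs : s v w 3 ≠ 1) (hσ : sigma v w 4 ≠ r v 4)
    {l : ℕ} (hl : 5 ≤ l) (hln : l ≤ n) :
    omegaNum v w l = (r v 4 ^ 2 - r v 4) / ((sigma v w 4 - r v 4) * ((s v w 3 - 1) *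
      ((entry w 2 - entry w 1) / (entry v 2 - entry v 1) ^ 3))) * excess v w l := by
  obtain ⟨A, B, C, D, hL⟩ := exists_lagrangeCubic_eq (entry v 1) (entry v 2) (entry v 3)
    (entry v 4) (entry w 1) (entry w 2) (entry w 3) (entry w 4)
  have hL' : ∀ x, cubicInterp v w x = A + B * x + C * x ^ 2 + D * x ^ 3 := hL
  have e := fun k h1 h4 => cubicInterp_nodes (k := k) hn hv w h1 h4
  have e1 := e 1 (by omega) (by omega)
  have e2 := e 2 (by omega) (by omega)
  have e3 := e 3 (by omega) (by omega)
  have e4 := e 4 (by omega) (by omega)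
  rw [hL'] at e1 e2 e3 e4
  have h2 := sub_ne_zero.2
    (entry_ne hv (i := 2) (j := 1) (by omega) (by omega) (by omega) (by omega) (by omega))
  have h3 := sub_ne_zero.2
    (entry_ne hv (i := 3) (j := 1) (by omega) (by omega) (by omega) (by omega) (by omega))
  have h4 := sub_ne_zero.2
    (entry_ne hv (i := 4) (j := 1) (by omega) (by omega) (by omega) (by omega) (by omega))
  have hl1 := sub_ne_zero.2
    (entry_ne hv (i := l) (j := 1) (by omega) (by omega) (by omega) (by omega) (by omega))
  have h32 := sub_ne_zero.2
    (entry_ne hv (i := 3) (j := 2) (by omega) (by omega) (by omega) (by omega) (by omega))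
  have hw' := sub_ne_zero.2 hw
  have hs' := sub_ne_zero.2 hs
  have hσ' := sub_ne_zero.2 hσ
  have hr4 := r_eq_crossRatio hn hv (j := 4) (by omega) (by omega)
  have hrl := r_eq_crossRatio hn hv (j := l) (by omega) (by omega)
  set κ := (entry w 2 - entry w 1) / (entry v 2 - entry v 1) ^ 3 with hκ
  have hκ0 : κ ≠ 0 := div_ne_zero hw' (pow_ne_zero _ h2)
  have hsk : ∀ k, entry v k - entry v 1 ≠ 0 →
      s v w k * κ = (entry w k - entry w 1) / (entry v k - entry v 1) ^ 3 := by
    intro k hk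
    unfold s diffRatio
    rw [hκ]
    field_simp
  have hdef : ∀ k, (sigma v w k - r v k) * ((s v w 3 - 1) * κ)
      = (s v w k * κ - κ) - r v k * (s v w 3 * κ - κ) := by
    intro k
    unfold sigma
    field_simp
  -- The slope at $v_1$ of the cubic through the first four elements: the only coefficient that
  -- survives in $\sigma-r$.
  set Q := (B + C * (2 * entry v 1) + D * (3 * entry v 1 ^ 2)) with hQ
  have hκ2 : κ = (entry w 2 - entry w 1) / (entry v 2 - entry v 1) ^ 3 := hκ
  have d4 : (sigma v w 4 - r v 4) * ((s v w 3 - 1) * κ)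
      = Q * ((entry v 4 - entry v 2) * (entry v 4 - entry v 3) /
        ((entry v 4 - entry v 1) ^ 2 * (entry v 2 - entry v 1) * (entry v 3 - entry v 1))) := by
    rw [hdef, hsk 4 h4, hsk 3 h3, hκ2, hr4, ← e1, ← e2, ← e3, ← e4, hQ]
    field_simp
    ring
  have dl : (sigma v w l - r v l) * ((s v w 3 - 1) * κ)
      = Q * ((entry v l - entry v 2) * (entry v l - entry v 3) /
        ((entry v l - entry v 1) ^ 2 * (entry v 2 - entry v 1) * (entry v 3 - entry v 1)))
        + excess v w l := by
    rw [hdef, hsk l hl1, hsk 3 h3, hκ2, hrl, excess, hL', ← e1, ← e2, ← e3, hQ]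
    field_simp
    ring
  have hD4 : (sigma v w 4 - r v 4) * ((s v w 3 - 1) * κ) ≠ 0 :=
    mul_ne_zero hσ' (mul_ne_zero hs' hκ0)
  have q4 : r v 4 ^ 2 - r v 4 = (entry v 2 - entry v 1) * (entry v 3 - entry v 1) *
      ((entry v 4 - entry v 2) * (entry v 4 - entry v 3)) /
      ((entry v 3 - entry v 2) ^ 2 * (entry v 4 - entry v 1) ^ 2) := by
    rw [hr4]; field_simp; ring
  have ql : r v l ^ 2 - r v l = (entry v 2 - entry v 1) * (entry v 3 - entry v 1) *
      ((entry v l - entry v 2) * (entry v l - entry v 3)) /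
      ((entry v 3 - entry v 2) ^ 2 * (entry v l - entry v 1) ^ 2) := by
    rw [hrl]; field_simp; ring
  have key : (r v 4 ^ 2 - r v 4) * ((sigma v w l - r v l) * ((s v w 3 - 1) * κ) - excess v w l)
      = (r v l ^ 2 - r v l) * ((sigma v w 4 - r v 4) * ((s v w 3 - 1) * κ)) := by
    rw [dl, d4, q4, ql]; field_simp; ring
  unfold omegaNum tau
  have : (s v w 3 - 1) * κ ≠ 0 := mul_ne_zero hs' hκ0
  generalize (s v w 3 - 1) * κ = m at *
  generalize r v l ^ 2 - r v l = ρ at *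
  generalize r v 4 ^ 2 - r v 4 = ρ' at *
  field_simp
  linear_combination key

/-- The cross-ratio of four distinct directions is neither $0$ nor $1$. -/
theorem r_sq_sub_ne_zero (hn : 4 ≤ n) {v : Fin n → K} (hv : Function.Injective v) :
    r v 4 ^ 2 - r v 4 ≠ 0 := by
  have h1 := sub_ne_zero.2
    (entry_ne hv (i := 2) (j := 1) (by omega) (by omega) (by omega) (by omega) (by omega))
  have h2 := sub_ne_zero.2
    (entry_ne hv (i := 3) (j := 1) (by omega) (by omega) (by omega) (by omega) (by omega))
  have h3 := sub_ne_zero.2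
    (entry_ne hv (i := 4) (j := 1) (by omega) (by omega) (by omega) (by omega) (by omega))
  have h4 := sub_ne_zero.2
    (entry_ne hv (i := 3) (j := 2) (by omega) (by omega) (by omega) (by omega) (by omega))
  have h5 := sub_ne_zero.2
    (entry_ne hv (i := 4) (j := 2) (by omega) (by omega) (by omega) (by omega) (by omega))
  have h6 := sub_ne_zero.2
    (entry_ne hv (i := 4) (j := 3) (by omega) (by omega) (by omega) (by omega) (by omega))
  have : r v 4 ^ 2 - r v 4 = (entry v 2 - entry v 1) * (entry v 3 - entry v 1) *
      ((entry v 4 - entry v 2) * (entry v 4 - entry v 3)) /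
      ((entry v 3 - entry v 2) ^ 2 * (entry v 4 - entry v 1) ^ 2) := by
    rw [r_eq_crossRatio hn hv (by omega) (by omega)]; field_simp; ring
  rw [this]
  positivity

/-- The prefactor in `omegaNum_eq` does not depend on `l` and cancels. -/
theorem Omega_eq (hn : 4 ≤ n) {v w : Fin n → K} (hv : Function.Injective v)
    (hw : entry w 2 ≠ entry w 1) (hs : s v w 3 ≠ 1) (hσ : sigma v w 4 ≠ r v 4)
    {l : ℕ} (hl : 5 ≤ l) (hln : l ≤ n) : Omega v w l = excess v w l / excess v w 5 := by
  unfold Omega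
  rw [omegaNum_eq hn hv hw hs hσ hl hln, omegaNum_eq hn hv hw hs hσ le_rfl (hl.trans hln)]
  refine mul_div_mul_left _ _ (div_ne_zero (r_sq_sub_ne_zero hn hv) ?_)
  exact mul_ne_zero (sub_ne_zero.2 hσ) (mul_ne_zero (sub_ne_zero.2 hs)
    (div_ne_zero (sub_ne_zero.2 hw) (pow_ne_zero _ (sub_ne_zero.2
    (entry_ne hv (by omega) (by omega) (by omega) (by omega) (by omega))))))

/-! ### Behaviour under the group. -/

section Action

variable [Algebra ℂ K]

/-- With $\Delta=ad-bc$, one has $1/(cv+d)=(a-cV)/\Delta$ and $v/(cv+d)=(dV-b)/\Delta$. A cubic in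
$v$ divided by $(cv+d)^3$ is thus a cubic form in $a-cV$ and $dV-b$, that is, a cubic in $V$. -/
theorem PointParam.exists_cubic (g : PointParam) (A B C D : K) :
    ∃ A' B' C' D' : K, ∀ v, g.den v ≠ 0 → g.actW v (A + B * v + C * v ^ 2 + D * v ^ 3)
      = A' + B' * g.actV v + C' * g.actV v ^ 2 + D' * g.actV v ^ 3 := by
  obtain ⟨a, b, c, d, l, m, nu, xi, h⟩ := g
  have hΔ : algebraMap ℂ K (a * d - b * c) ≠ 0 := by rwa [ne_eq, FaithfulSMul.algebraMap_eq_zero_iff]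
  unfold PointParam.actW PointParam.actV PointParam.den
  simp only [map_sub, map_mul] at hΔ ⊢
  generalize algebraMap ℂ K a = a at *
  generalize algebraMap ℂ K b = b at *
  generalize algebraMap ℂ K c = c at *
  generalize algebraMap ℂ K d = d at *
  generalize algebraMap ℂ K l = l at *
  generalize algebraMap ℂ K m = m at *
  generalize algebraMap ℂ K nu = nu at *
  generalize algebraMap ℂ K xi = xi at *
  set Δ := a * d - b * c with hΔd
  -- The translation part of `g` and the given cubic merge into one cubic with coefficients `m0`, …,
  -- `m3`.
  obtain ⟨m0, h0⟩ : ∃ m0, m0 = l + Δ * A := ⟨_, rfl⟩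
  obtain ⟨m1, h1⟩ : ∃ m1, m1 = m + Δ * B := ⟨_, rfl⟩
  obtain ⟨m2, h2⟩ : ∃ m2, m2 = nu + Δ * C := ⟨_, rfl⟩
  obtain ⟨m3, h3⟩ : ∃ m3, m3 = xi + Δ * D := ⟨_, rfl⟩
  refine ⟨(m0 * a ^ 3 - m1 * b * a ^ 2 + m2 * b ^ 2 * a - m3 * b ^ 3) / Δ ^ 3,
    (-3 * m0 * a ^ 2 * c + m1 * (d * a ^ 2 + 2 * a * b * c) - m2 * (2 * b * d * a + b ^ 2 * c)
      + 3 * m3 * b ^ 2 * d) / Δ ^ 3,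
    (3 * m0 * a * c ^ 2 - m1 * (2 * a * c * d + b * c ^ 2) + m2 * (d ^ 2 * a + 2 * b * c * d)
      - 3 * m3 * b * d ^ 2) / Δ ^ 3,
    (-m0 * c ^ 3 + m1 * d * c ^ 2 - m2 * d ^ 2 * c + m3 * d ^ 3) / Δ ^ 3, fun v hv => ?_⟩
  have : l + m * v + nu * v ^ 2 + xi * v ^ 3 + Δ * (A + B * v + C * v ^ 2 + D * v ^ 3)
      = m0 + m1 * v + m2 * v ^ 2 + m3 * v ^ 3 := by rw [h0, h1, h2, h3]; ring
  rw [this]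
  have e1 : a - c * ((a * v + b) / (c * v + d)) = Δ / (c * v + d) := by
    field_simp; rw [hΔd]; ring
  have e2 : d * ((a * v + b) / (c * v + d)) - b = Δ * v / (c * v + d) := by
    rw [eq_div_iff hv, sub_mul, mul_assoc, div_mul_cancel₀ _ hv, hΔd]; ring
  generalize (a * v + b) / (c * v + d) = V at *
  clear_value Δ
  have e3 : (m0 + m1 * v + m2 * v ^ 2 + m3 * v ^ 3) / (c * v + d) ^ 3
      = (m0 * (a - c * V) ^ 3 + m1 * (d * V - b) * (a - c * V) ^ 2
        + m2 * (d * V - b) ^ 2 * (a - c * V) + m3 * (d * V - b) ^ 3) / Δ ^ 3 := by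
    rw [e1, e2]; field_simp
  rw [e3]
  ring

theorem PointParam.actV_sub (g : PointParam) {x y : K} (hx : g.den x ≠ 0) (hy : g.den y ≠ 0) :
    g.actV x - g.actV y
      = algebraMap ℂ K (g.a * g.d - g.b * g.c) * (x - y) / (g.den x * g.den y) := by
  unfold PointParam.actV
  rw [div_sub_div _ _ hx hy]
  simp only [PointParam.den, map_sub, map_mul]
  ring

theorem PointParam.actW_sub (g : PointParam) (v w w' : K) :
    g.actW v w - g.actW v w'
      = algebraMap ℂ K (g.a * g.d - g.b * g.c) * (w - w') / g.den v ^ 3 := by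
  unfold PointParam.actW
  ring

theorem PointParam.algebraMap_det_ne_zero (g : PointParam) :
    algebraMap ℂ K (g.a * g.d - g.b * g.c) ≠ 0 := by
  rw [ne_eq, FaithfulSMul.algebraMap_eq_zero_iff]; exact g.det_ne_zero

variable {p : (Fin n → K) × (Fin n → K)} {g : PointParam}

theorem DefinedAt.den_entry (hg : g.DefinedAt p) {k : ℕ} (h1 : 1 ≤ k) (h2 : k ≤ n) :
    g.den (entry p.1 k) ≠ 0 := by
  rw [entry_of_le _ h1 h2]; exact hg _

theorem entry_act_fst {k : ℕ} (h1 : 1 ≤ k) (h2 : k ≤ n) :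
    entry (g.act p).1 k = g.actV (entry p.1 k) := by
  rw [entry_of_le _ h1 h2, entry_of_le _ h1 h2]; rfl

theorem entry_act_snd {k : ℕ} (h1 : 1 ≤ k) (h2 : k ≤ n) :
    entry (g.act p).2 k = g.actW (entry p.1 k) (entry p.2 k) := by
  rw [entry_of_le _ h1 h2, entry_of_le _ h1 h2, entry_of_le _ h1 h2]; rfl

theorem injective_act (hg : g.DefinedAt p) (hv : Function.Injective p.1) :
    Function.Injective (g.act p).1 := by
  intro i j h
  have : g.actV (p.1 i) - g.actV (p.1 j) = 0 := sub_eq_zero.2 h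
  rw [g.actV_sub (hg i) (hg j), div_eq_zero_iff, mul_eq_zero, mul_eq_zero] at this
  rcases this with (h | h) | h | h
  · exact absurd h g.algebraMap_det_ne_zero
  · exact hv (sub_eq_zero.1 h)
  · exact absurd h (hg i)
  · exact absurd h (hg j)

/-- By `actV_sub` a difference of two directions acquires the determinant and one denominator for
each endpoint; in a cross-ratio these all cancel. -/
theorem r_act (hn : 4 ≤ n) (hg : g.DefinedAt p) (hv : Function.Injective p.1) {j : ℕ}
    (hj : 4 ≤ j) (hjn : j ≤ n) : r (g.act p).1 j = r p.1 j := by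
  rw [r_eq_crossRatio hn hv hj hjn, r_eq_crossRatio hn (injective_act hg hv) hj hjn]
  have d1 := DefinedAt.den_entry hg (k := 1) (by omega) (by omega)
  have d2 := DefinedAt.den_entry hg (k := 2) (by omega) (by omega)
  have d3 := DefinedAt.den_entry hg (k := 3) (by omega) (by omega)
  have dj := DefinedAt.den_entry hg (k := j) (by omega) (by omega)
  have hΔ := g.algebraMap_det_ne_zero (K := K)
  have h2 := sub_ne_zero.2
    (entry_ne hv (i := 3) (j := 2) (by omega) (by omega) (by omega) (by omega) (by omega))
  have h3 := sub_ne_zero.2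
    (entry_ne hv (i := j) (j := 1) (by omega) (by omega) (by omega) (by omega) (by omega))
  rw [entry_act_fst (by omega) (by omega), entry_act_fst (by omega) (by omega),
    entry_act_fst (by omega) (by omega), entry_act_fst (by omega) (by omega),
    g.actV_sub d3 d1, g.actV_sub dj d2, g.actV_sub d3 d2, g.actV_sub dj d1]
  field_simp

/-- The interpolating cubic is carried to the interpolating cubic of the image. The deviation is
multiplied by $\Delta/(cv_l+d)^3$ and $(v_l-v_1)^3$ by $\Delta^3/((cv_l+d)(cv_1+d))^3$, so the
weight removes the dependence on `l`. -/
theorem excess_act (hn : 4 ≤ n) (hg : g.DefinedAt p) (hv : Function.Injective p.1) {l : ℕ}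
    (hl : 5 ≤ l) (hln : l ≤ n) : excess (g.act p).1 (g.act p).2 l
      = g.den (entry p.1 1) ^ 3 / algebraMap ℂ K (g.a * g.d - g.b * g.c) ^ 2
        * excess p.1 p.2 l := by
  obtain ⟨A, B, C, D, hL⟩ := exists_lagrangeCubic_eq (entry p.1 1) (entry p.1 2) (entry p.1 3)
    (entry p.1 4) (entry p.2 1) (entry p.2 2) (entry p.2 3) (entry p.2 4)
  have hL' : ∀ x, cubicInterp p.1 p.2 x = A + B * x + C * x ^ 2 + D * x ^ 3 := hL
  obtain ⟨A', B', C', D', h'⟩ := g.exists_cubic A B C D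
  have hI := cubicInterp_eq_cubic (w := (g.act p).2) (A := A') (B := B') (C := C') (D := D') hn
    (injective_act hg hv) (fun k h1 h4 => by
      rw [entry_act_fst h1 (by omega), entry_act_snd h1 (by omega),
        ← cubicInterp_nodes hn hv p.2 h1 h4, hL',
        h' _ (DefinedAt.den_entry hg h1 (by omega))])
  have d1 := DefinedAt.den_entry hg (k := 1) (by omega) (by omega)
  have dl := DefinedAt.den_entry hg (k := l) (by omega) (by omega)
  have hΔ := g.algebraMap_det_ne_zero (K := K)
  have h3 := sub_ne_zero.2
    (entry_ne hv (i := l) (j := 1) (by omega) (by omega) (by omega) (by omega) (by omega))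
  unfold excess
  rw [hI, entry_act_fst (by omega) (by omega), entry_act_snd (by omega) (by omega),
    entry_act_fst (by omega) (by omega), ← h' _ dl, g.actW_sub, g.actV_sub dl d1, hL']
  field_simp

theorem excess_ratio_act (hn : 4 ≤ n) (hg : g.DefinedAt p) (hv : Function.Injective p.1) {l : ℕ}
    (hl : 5 ≤ l) (hln : l ≤ n) :
    excess (g.act p).1 (g.act p).2 l / excess (g.act p).1 (g.act p).2 5
      = excess p.1 p.2 l / excess p.1 p.2 5 := by
  rw [excess_act hn hg hv hl hln, excess_act hn hg hv le_rfl (by omega)]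
  exact mul_div_mul_left _ _ (div_ne_zero
    (pow_ne_zero _ (DefinedAt.den_entry hg (by omega) (by omega)))
    (pow_ne_zero _ g.algebraMap_det_ne_zero))

end Action

/-- The invariants are defined at `p`: the `v_i` are distinct and no denominator vanishes. -/
def Nondegenerate (p : (Fin n → K) × (Fin n → K)) : Prop :=
  Function.Injective p.1 ∧
  (6 ≤ n → entry p.2 2 ≠ entry p.2 1 ∧ s p.1 p.2 3 ≠ 1 ∧ sigma p.1 p.2 4 ≠ r p.1 4 ∧
    omegaNum p.1 p.2 5 ≠ 0)

theorem fundInv_inr (hn : 4 ≤ n) {p : (Fin n → K) × (Fin n → K)} (hp : Nondegenerate p)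
    (l : Fin (n - 5)) :
    fundInv p (Sum.inr l) = excess p.1 p.2 (l + 6) / excess p.1 p.2 5 := by
  obtain ⟨h1, h2, h3, -⟩ := hp.2 (by have := l.2; omega)
  exact Omega_eq hn hp.1 h1 h2 h3 (by omega) (by omega)

theorem fundInv_act [Algebra ℂ K] (hn : 4 ≤ n) {p : (Fin n → K) × (Fin n → K)} {g : PointParam}
    (hg : g.DefinedAt p) (hp : Nondegenerate p) (hp' : Nondegenerate (g.act p)) :
    fundInv (g.act p) = fundInv p := by
  ext (j | l)
  · exact r_act hn hg hp.1 (by omega) (by omega)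
  · rw [fundInv_inr hn hp, fundInv_inr hn hp']
    exact excess_ratio_act hn hg hp.1 (by omega) (by omega)

end Field

/-! ### A rational section of the invariants. -/

section Reconstruction

variable {K : Type*} [Field K] {n : ℕ}

/-- The direction that has the cross-ratio `ρ` with `a`, `b`, `c`. -/
def directionOf (a b c ρ : K) : K :=
  (ρ * (c - b) * a - (c - a) * b) / (ρ * (c - b) - (c - a))

/-- The directions with the first three entries of `v` and the cross-ratios `y`. -/
def reconstructV (v : Fin n → K) (y : InvIndex n → K) (i : Fin n) : K :=
  if h : 3 ≤ (i : ℕ) then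
    directionOf (entry v 1) (entry v 2) (entry v 3) (y (Sum.inl ⟨i - 3, by omega⟩))
  else v i

/-- The second coordinates that complete the directions `v`, the first five entries of `w` and
the values `y` of the invariants. -/
def reconstructW (v w : Fin n → K) (y : InvIndex n → K) (i : Fin n) : K :=
  if h : 5 ≤ (i : ℕ) then
    cubicInterp v w (v i)
      + y (Sum.inr ⟨i - 5, by omega⟩) * excess v w 5 * (v i - entry v 1) ^ 3
  else w i

/-- The tuple that shares with `q` the first three directions and the first five second
coordinates and on which the fundamental invariants take the values `y`. -/
def reconstruct (q : (Fin n → K) × (Fin n → K)) (y : InvIndex n → K) :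
    (Fin n → K) × (Fin n → K) :=
  (reconstructV q.1 y, reconstructW (reconstructV q.1 y) q.2 y)

/-- Outside the range $1\le k\le n$ both entries are the default $0$, so `k` needs no lower bound.
-/
theorem entry_congr {x x' : Fin n → K} {m k : ℕ} (h : ∀ i : Fin n, (i : ℕ) < m → x i = x' i)
    (hk : k ≤ m) : entry x k = entry x' k := by
  unfold entry
  split_ifs with h1
  · exact h _ (by simp; omega)
  · rfl

/-- These eight coordinates match the eight dimensions of the group: fixing them makes a tuple rigid
within a level set of the invariants. -/
theorem reconstruct_congr {q q' : (Fin n → K) × (Fin n → K)}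
    (h1 : ∀ i : Fin n, (i : ℕ) < 3 → q.1 i = q'.1 i)
    (h2 : ∀ i : Fin n, (i : ℕ) < 5 → q.2 i = q'.2 i) (y : InvIndex n → K) :
    reconstruct q y = reconstruct q' y := by
  have hV : reconstructV q.1 y = reconstructV q'.1 y := by
    ext i
    unfold reconstructV
    split_ifs with h
    · rw [entry_congr h1 (k := 1) (by omega), entry_congr h1 (k := 2) (by omega),
        entry_congr h1 (k := 3) (by omega)]
    · exact h1 i (by omega)
  unfold reconstruct
  rw [hV]
  congr 1
  ext i
  unfold reconstructW
  split_ifs with h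
  · unfold excess cubicInterp
    rw [entry_congr h2 (k := 1) (by omega), entry_congr h2 (k := 2) (by omega),
        entry_congr h2 (k := 3) (by omega), entry_congr h2 (k := 4) (by omega),
        entry_congr h2 (k := 5) (by omega)]
  · exact h2 i (by omega)

theorem excess_ne_zero (hn : 6 ≤ n) {p : (Fin n → K) × (Fin n → K)} (hp : Nondegenerate p) :
    excess p.1 p.2 5 ≠ 0 := by
  obtain ⟨h1, h2, h3, h4⟩ := hp.2 hn
  rw [omegaNum_eq (by omega) hp.1 h1 h2 h3 le_rfl (by omega)] at h4
  exact right_ne_zero_of_mul h4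

/-- The expression vanishes only at the cross-ratio belonging to the direction $\infty$. -/
theorem directionOf_den_ne_zero (hn : 4 ≤ n) {v : Fin n → K} (hv : Function.Injective v) {j : ℕ}
    (hj : 4 ≤ j) (hjn : j ≤ n) :
    r v j * (entry v 3 - entry v 2) - (entry v 3 - entry v 1) ≠ 0 := by
  have h1 := sub_ne_zero.2
    (entry_ne hv (i := 3) (j := 1) (by omega) (by omega) (by omega) (by omega) (by omega))
  have h2 := sub_ne_zero.2
    (entry_ne hv (i := 1) (j := 2) (by omega) (by omega) (by omega) (by omega) (by omega))
  have h3 := sub_ne_zero.2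
    (entry_ne hv (i := j) (j := 1) (by omega) (by omega) (by omega) (by omega) (by omega))
  have h4 := sub_ne_zero.2
    (entry_ne hv (i := 3) (j := 2) (by omega) (by omega) (by omega) (by omega) (by omega))
  have : r v j * (entry v 3 - entry v 2) - (entry v 3 - entry v 1)
      = (entry v 3 - entry v 1) * (entry v 1 - entry v 2) / (entry v j - entry v 1) := by
    rw [r_eq_crossRatio hn hv hj hjn]; field_simp; ring
  rw [this]
  exact div_ne_zero (mul_ne_zero h1 h2) h3

theorem directionOf_r (hn : 4 ≤ n) {v : Fin n → K} (hv : Function.Injective v) {j : ℕ}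
    (hj : 4 ≤ j) (hjn : j ≤ n) :
    directionOf (entry v 1) (entry v 2) (entry v 3) (r v j) = entry v j := by
  have h := directionOf_den_ne_zero hn hv hj hjn
  have h3 := sub_ne_zero.2
    (entry_ne hv (i := j) (j := 1) (by omega) (by omega) (by omega) (by omega) (by omega))
  have h4 := sub_ne_zero.2
    (entry_ne hv (i := 3) (j := 2) (by omega) (by omega) (by omega) (by omega) (by omega))
  unfold directionOf
  rw [div_eq_iff h, r_eq_crossRatio hn hv hj hjn]
  field_simp
  ring

theorem reconstructV_r (hn : 4 ≤ n) {v : Fin n → K} (hv : Function.Injective v)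
    {y : InvIndex n → K} (hy : ∀ j : Fin (n - 3), y (Sum.inl j) = r v (j + 4)) :
    reconstructV v y = v := by
  ext i
  unfold reconstructV
  split_ifs with h
  · rw [hy, directionOf_r hn hv (by omega) (by simp; omega), ← entry_succ v i]
    congr 1
    simp; omega
  · rfl

/-- A tuple is reconstructed from its invariants. -/
theorem reconstruct_fundInv (hn : 4 ≤ n) {q : (Fin n → K) × (Fin n → K)} (hq : Nondegenerate q) :
    reconstruct q (fundInv q) = q := by
  have hV : reconstructV q.1 (fundInv q) = q.1 := reconstructV_r hn hq.1 fun j => rfl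
  unfold reconstruct
  rw [hV]
  refine Prod.ext rfl (funext fun i => ?_)
  change reconstructW q.1 q.2 (fundInv q) i = q.2 i
  unfold reconstructW
  split_ifs with h
  · have h6 : 6 ≤ n := by omega
    -- Positions in `Fin n` start at $0$, entries and indices of invariants at $1$: position `i`
    -- carries the invariant with index `i + 1`.
    have hi : (i : ℕ) - 5 + 6 = i + 1 := by omega
    have h3 := sub_ne_zero.2 (entry_ne hq.1 (i := i + 1) (j := 1) (by omega) (by omega)
      (by omega) (by omega) (by omega))
    rw [fundInv_inr hn hq, div_mul_cancel₀ _ (excess_ne_zero h6 hq)]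
    simp only [hi]
    rw [← entry_succ q.1 i, excess, div_mul_cancel₀ _ (pow_ne_zero _ h3), entry_succ q.2 i]
    ring
  · rfl

/-- The reconstruction from `q` and `y` meets no vanishing denominator. -/
def Reconstructible (q : (Fin n → K) × (Fin n → K)) (y : InvIndex n → K) : Prop :=
  (∀ j, y (Sum.inl j) * (entry q.1 3 - entry q.1 2) - (entry q.1 3 - entry q.1 1) ≠ 0) ∧
    Nondegenerate (reconstruct q y)

theorem reconstructible_fundInv (hn : 4 ≤ n) {q : (Fin n → K) × (Fin n → K)}
    (hq : Nondegenerate q) : Reconstructible q (fundInv q) :=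
  ⟨fun j => directionOf_den_ne_zero hn hq.1 (by omega) (by omega),
    by rwa [reconstruct_fundInv hn hq]⟩

theorem entry_reconstructV_of_le (v : Fin n → K) (y : InvIndex n → K) {k : ℕ}
    (hk : k ≤ 3) : entry (reconstructV v y) k = entry v k :=
  entry_congr (m := 3) (fun i hi => dif_neg (by omega)) hk

theorem entry_reconstructW_of_le (v w : Fin n → K) (y : InvIndex n → K) {k : ℕ}
    (hk : k ≤ 5) : entry (reconstructW v w y) k = entry w k :=
  entry_congr (m := 5) (fun i hi => dif_neg (by omega)) hk

theorem cubicInterp_reconstructW (v w : Fin n → K) (y : InvIndex n → K) :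
    cubicInterp v (reconstructW v w y) = cubicInterp v w := by
  ext x
  unfold cubicInterp
  rw [entry_reconstructW_of_le v w y (k := 1) (by omega),
    entry_reconstructW_of_le v w y (k := 2) (by omega),
    entry_reconstructW_of_le v w y (k := 3) (by omega),
    entry_reconstructW_of_le v w y (k := 4) (by omega)]

theorem excess_reconstructW (v w : Fin n → K) (y : InvIndex n → K) :
    excess v (reconstructW v w y) 5 = excess v w 5 := by
  unfold excess
  rw [cubicInterp_reconstructW, entry_reconstructW_of_le v w y (k := 5) (by omega)]

/-- The invariants of the reconstructed tuple are the prescribed ones. -/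
theorem fundInv_reconstruct (hn : 4 ≤ n) {q : (Fin n → K) × (Fin n → K)} {y : InvIndex n → K}
    (h : Reconstructible q y) : fundInv (reconstruct q y) = y := by
  obtain ⟨hd, hN⟩ := h
  have hv : Function.Injective (reconstructV q.1 y) := hN.1
  have hlow := fun k hk => entry_reconstructV_of_le q.1 y (k := k) hk
  ext (j | l)
  · change r (reconstructV q.1 y) (j + 4) = _
    have hj := j.2
    have h1 := sub_ne_zero.2
      (entry_ne hv (i := 3) (j := 1) (by omega) (by omega) (by omega) (by omega) (by omega))
    have h2 := sub_ne_zero.2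
      (entry_ne hv (i := 1) (j := 2) (by omega) (by omega) (by omega) (by omega) (by omega))
    have h4 := sub_ne_zero.2
      (entry_ne hv (i := 3) (j := 2) (by omega) (by omega) (by omega) (by omega) (by omega))
    rw [r_eq_crossRatio hn hv (by omega) (by omega)]
    rw [hlow 1 (by omega), hlow 2 (by omega)] at *
    rw [hlow 3 (by omega)] at *
    have he : entry (reconstructV q.1 y) (j + 4)
        = directionOf (entry q.1 1) (entry q.1 2) (entry q.1 3) (y (Sum.inl j)) := by
      rw [entry_of_le _ (by omega) (by omega)]
      exact dif_pos (show 3 ≤ (j : ℕ) + 4 - 1 by omega)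
    have hm := hd j
    rw [he]
    unfold directionOf
    generalize y (Sum.inl j) = ρ at *
    -- The differences of the reconstructed direction from $v_2$ and $v_1$ have the same
    -- denominator; their quotient gives back `ρ`.
    have e1 : (ρ * (entry q.1 3 - entry q.1 2) * entry q.1 1
        - (entry q.1 3 - entry q.1 1) * entry q.1 2)
        / (ρ * (entry q.1 3 - entry q.1 2) - (entry q.1 3 - entry q.1 1)) - entry q.1 2
        = ρ * (entry q.1 3 - entry q.1 2) * (entry q.1 1 - entry q.1 2)
        / (ρ * (entry q.1 3 - entry q.1 2) - (entry q.1 3 - entry q.1 1)) := by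
      rw [eq_div_iff hm, sub_mul, div_mul_cancel₀ _ hm]; ring
    have e2 : (ρ * (entry q.1 3 - entry q.1 2) * entry q.1 1
        - (entry q.1 3 - entry q.1 1) * entry q.1 2)
        / (ρ * (entry q.1 3 - entry q.1 2) - (entry q.1 3 - entry q.1 1)) - entry q.1 1
        = (entry q.1 3 - entry q.1 1) * (entry q.1 1 - entry q.1 2)
        / (ρ * (entry q.1 3 - entry q.1 2) - (entry q.1 3 - entry q.1 1)) := by
      rw [eq_div_iff hm, sub_mul, div_mul_cancel₀ _ hm]; ring
    rw [e1, e2]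
    generalize ρ * (entry q.1 3 - entry q.1 2) - (entry q.1 3 - entry q.1 1) = m at *
    field_simp
  · have hl := l.2
    have he := excess_ne_zero (by omega) hN
    rw [fundInv_inr hn hN, div_eq_iff he]
    change excess (reconstructV q.1 y) (reconstructW (reconstructV q.1 y) q.2 y) (l + 6) =
      y (Sum.inr l) * excess (reconstructV q.1 y) (reconstructW (reconstructV q.1 y) q.2 y) 5
    have hW : entry (reconstructW (reconstructV q.1 y) q.2 y) (l + 6)
        = cubicInterp (reconstructV q.1 y) q.2 (entry (reconstructV q.1 y) (l + 6))
          + y (Sum.inr l) * excess (reconstructV q.1 y) q.2 5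
            * (entry (reconstructV q.1 y) (l + 6) - entry (reconstructV q.1 y) 1) ^ 3 := by
      rw [entry_of_le _ (by omega) (by omega), entry_of_le (reconstructV q.1 y)
        (k := l + 6) (by omega) (by omega)]
      exact dif_pos (show 5 ≤ (l : ℕ) + 6 - 1 by omega)
    have h3 := sub_ne_zero.2 (entry_ne hv (i := l + 6) (j := 1) (by omega) (by omega)
      (by omega) (by omega) (by omega))
    rw [excess_reconstructW, excess, cubicInterp_reconstructW, hW, add_sub_cancel_left,
      mul_div_cancel_right₀ _ (pow_ne_zero _ h3)]

end Reconstruction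

/-! ### Generic orbits are the level sets of the invariants. -/

section Orbits

variable {n : ℕ}

theorem lagrangeCubic_sub_mul {K : Type*} [Field K] (a b c d p q r s p' q' r' s' κ x : K) :
    lagrangeCubic a b c d (p - κ * p') (q - κ * q') (r - κ * r') (s - κ * s') x
      = lagrangeCubic a b c d p q r s x - κ * lagrangeCubic a b c d p' q' r' s' x := by
  unfold lagrangeCubic
  ring

theorem cubicInterp_sub_mul (hn : 4 ≤ n) {K : Type*} [Field K] (v w w' : Fin n → K) (κ x : K) :
    cubicInterp v (fun i => w i - κ * w' i) x = cubicInterp v w x - κ * cubicInterp v w' x := by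
  have h : ∀ k, 1 ≤ k → k ≤ n →
      entry (fun i => w i - κ * w' i) k = entry w k - κ * entry w' k := fun k h1 h2 => by
    rw [entry_of_le _ h1 h2, entry_of_le _ h1 h2, entry_of_le _ h1 h2]
  unfold cubicInterp
  rw [h 1 (by omega) (by omega), h 2 (by omega) (by omega), h 3 (by omega) (by omega),
    h 4 (by omega) (by omega), lagrangeCubic_sub_mul]

/-- A cubic containing the first five elements must be the interpolating cubic of the first four. -/
theorem excess_eq_zero_iff (hn : 4 ≤ n) {p : (Fin n → ℂ) × (Fin n → ℂ)}
    (hv : Function.Injective p.1) (h5 : 5 ≤ n) : excess p.1 p.2 5 = 0 ↔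
    ∃ A B C D : ℂ, ∀ k : ℕ, 1 ≤ k → k ≤ 5 →
      entry p.2 k = A + B * entry p.1 k + C * entry p.1 k ^ 2 + D * entry p.1 k ^ 3 := by
  have h3 := sub_ne_zero.2 (entry_ne hv (i := 5) (j := 1) (by omega) (by omega)
      (by omega) (by omega) (by omega))
  unfold excess
  rw [div_eq_zero_iff, or_iff_left (pow_ne_zero _ h3), sub_eq_zero]
  constructor
  · intro h
    obtain ⟨A, B, C, D, hL⟩ := exists_lagrangeCubic_eq (entry p.1 1) (entry p.1 2) (entry p.1 3)
      (entry p.1 4) (entry p.2 1) (entry p.2 2) (entry p.2 3) (entry p.2 4)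
    refine ⟨A, B, C, D, fun k h1 hk => ?_⟩
    rw [← hL]
    rcases hk.lt_or_eq with hk | rfl
    · exact (cubicInterp_nodes hn hv p.2 h1 (by omega)).symm
    · exact h
  · rintro ⟨A, B, C, D, h⟩
    rw [h 5 (by omega) le_rfl]
    exact (cubicInterp_eq_cubic hn hv (fun k h1 h4 => h k h1 (by omega)) _).symm

/-- The Möbius map taking three directions to three directions is found by solving the equality of
cross-ratios for $V$; equality of the $r_j$ says that it takes every other direction to its partner.
-/
theorem exists_moebius (hn : 4 ≤ n) {v V : Fin n → ℂ} (hv : Function.Injective v)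
    (hV : Function.Injective V) (hr : ∀ j, 4 ≤ j → j ≤ n → r v j = r V j) :
    ∃ a b c d : ℂ, a * d - b * c ≠ 0 ∧ ∀ i, c * v i + d ≠ 0 ∧ V i * (c * v i + d) = a * v i + b := by
  have v21 := sub_ne_zero.2
    (entry_ne hv (i := 2) (j := 1) (by omega) (by omega) (by omega) (by omega) (by omega))
  have v31 := sub_ne_zero.2
    (entry_ne hv (i := 3) (j := 1) (by omega) (by omega) (by omega) (by omega) (by omega))
  have v32 := sub_ne_zero.2
    (entry_ne hv (i := 3) (j := 2) (by omega) (by omega) (by omega) (by omega) (by omega))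
  have V21 := sub_ne_zero.2
    (entry_ne hV (i := 2) (j := 1) (by omega) (by omega) (by omega) (by omega) (by omega))
  have V31 := sub_ne_zero.2
    (entry_ne hV (i := 3) (j := 1) (by omega) (by omega) (by omega) (by omega) (by omega))
  have V32 := sub_ne_zero.2
    (entry_ne hV (i := 3) (j := 2) (by omega) (by omega) (by omega) (by omega) (by omega))
  have hcr : ∀ j, 4 ≤ j → j ≤ n →
      (entry v 3 - entry v 1) * (entry v j - entry v 2) *
        ((entry V 3 - entry V 2) * (entry V j - entry V 1)) =
      (entry V 3 - entry V 1) * (entry V j - entry V 2) *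
        ((entry v 3 - entry v 2) * (entry v j - entry v 1)) := by
    intro j hj hjn
    have vj1 := sub_ne_zero.2
      (entry_ne hv (i := j) (j := 1) (by omega) (by omega) (by omega) (by omega) (by omega))
    have Vj1 := sub_ne_zero.2
      (entry_ne hV (i := j) (j := 1) (by omega) (by omega) (by omega) (by omega) (by omega))
    have := hr j hj hjn
    rwa [r_eq_crossRatio hn hv hj hjn, r_eq_crossRatio hn hV hj hjn,
      div_eq_div_iff (mul_ne_zero v32 vj1) (mul_ne_zero V32 Vj1)] at this
  have main : ∀ k, 1 ≤ k → k ≤ n →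
      (entry V 3 - entry V 1) * (entry v 3 - entry v 2) * (entry v k - entry v 1)
        - (entry V 3 - entry V 2) * (entry v 3 - entry v 1) * (entry v k - entry v 2) ≠ 0 ∧
      entry V k * ((entry V 3 - entry V 1) * (entry v 3 - entry v 2) * (entry v k - entry v 1)
        - (entry V 3 - entry V 2) * (entry v 3 - entry v 1) * (entry v k - entry v 2)) =
      entry V 2 * ((entry V 3 - entry V 1) * (entry v 3 - entry v 2) * (entry v k - entry v 1))
        - entry V 1 * ((entry V 3 - entry V 2) * (entry v 3 - entry v 1) *
          (entry v k - entry v 2)) := by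
    intro k h1 hk
    by_cases h4 : 4 ≤ k
    · have vk1 := sub_ne_zero.2
        (entry_ne hv (i := k) (j := 1) (by omega) (by omega) (by omega) (by omega) (by omega))
      have Vk1 := sub_ne_zero.2
        (entry_ne hV (i := k) (j := 1) (by omega) (by omega) (by omega) (by omega) (by omega))
      have h := hcr k h4 hk
      constructor
      · intro h0
        have : (entry V 3 - entry V 1) * (entry v 3 - entry v 2) * (entry v k - entry v 1) *
            (entry V 2 - entry V 1) = 0 := by linear_combination (entry V k - entry V 1) * h0 + h
        exact mul_ne_zero (mul_ne_zero (mul_ne_zero V31 v32) vk1) V21 this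
      · linear_combination -h
    · interval_cases k
      · refine ⟨?_, by ring⟩
        have := mul_ne_zero (mul_ne_zero V32 v31) v21
        intro h; apply this; linear_combination h
      · refine ⟨?_, by ring⟩
        have := mul_ne_zero (mul_ne_zero V31 v32) v21
        intro h; apply this; linear_combination h
      · refine ⟨?_, by ring⟩
        have := mul_ne_zero (mul_ne_zero v31 v32) V21
        intro h; apply this; linear_combination h
  -- The coefficients of $v$ and $1$ in the numerator and the denominator of `main`. The determinant
  -- is a product of six differences of nodes.
  refine ⟨entry V 2 * ((entry V 3 - entry V 1) * (entry v 3 - entry v 2))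
      - entry V 1 * ((entry V 3 - entry V 2) * (entry v 3 - entry v 1)),
    -(entry V 2 * ((entry V 3 - entry V 1) * (entry v 3 - entry v 2) * entry v 1))
      + entry V 1 * ((entry V 3 - entry V 2) * (entry v 3 - entry v 1) * entry v 2),
    (entry V 3 - entry V 1) * (entry v 3 - entry v 2)
      - (entry V 3 - entry V 2) * (entry v 3 - entry v 1),
    -((entry V 3 - entry V 1) * (entry v 3 - entry v 2) * entry v 1)
      + (entry V 3 - entry V 2) * (entry v 3 - entry v 1) * entry v 2, ?_, fun i => ?_⟩
  · have := mul_ne_zero (mul_ne_zero (mul_ne_zero V31 v32) (mul_ne_zero V32 v31))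
      (mul_ne_zero V21 v21)
    intro h; apply this; linear_combination h
  · obtain ⟨h1, h2⟩ := main (i + 1) (by omega) i.2
    rw [entry_succ, entry_succ] at h2
    rw [entry_succ] at h1
    refine ⟨fun h => h1 (by linear_combination h), by linear_combination h2⟩

/-- Tuples with the same invariants are equivalent under the group. -/
theorem exists_act_eq (hn : 4 ≤ n) {p q : (Fin n → ℂ) × (Fin n → ℂ)}
    (hp : Function.Injective p.1) (hq : Function.Injective q.1)
    (hp5 : 5 ≤ n → excess p.1 p.2 5 ≠ 0) (hq5 : 5 ≤ n → excess q.1 q.2 5 ≠ 0)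
    (hr : ∀ j, 4 ≤ j → j ≤ n → r p.1 j = r q.1 j)
    (hΩ : ∀ l, 6 ≤ l → l ≤ n →
      excess p.1 p.2 l / excess p.1 p.2 5 = excess q.1 q.2 l / excess q.1 q.2 5) :
    ∃ g : PointParam, g.DefinedAt p ∧ g.act p = q := by
  obtain ⟨a, b, c, d, hΔ, hm⟩ := exists_moebius hn hp hq hr
  -- A transformation without cubic part first brings the directions of `p` to those of `q`.
  have hh : (⟨a, b, c, d, 0, 0, 0, 0, hΔ⟩ : PointParam).DefinedAt p := fun i => (hm i).1
  have hV : ((⟨a, b, c, d, 0, 0, 0, 0, hΔ⟩ : PointParam).act p).1 = q.1 := by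
    ext i
    exact (div_eq_iff (hm i).1).2 (hm i).2.symm
  have hW : ∀ i, ((⟨a, b, c, d, 0, 0, 0, 0, hΔ⟩ : PointParam).act p).2 i
      = (a * d - b * c) * p.2 i / (c * p.1 i + d) ^ 3 := by
    intro i
    change ((0 : ℂ) + 0 * p.1 i + 0 * p.1 i ^ 2 + 0 * p.1 i ^ 3 + (a * d - b * c) * p.2 i)
      / (c * p.1 i + d) ^ 3 = _
    ring
  have hex := fun l hl hln => excess_act (l := l) hn hh hp hl hln
  have hra := fun l hl hln => excess_ratio_act (l := l) hn hh hp hl hln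
  set p' := (⟨a, b, c, d, 0, 0, 0, 0, hΔ⟩ : PointParam).act p
  rw [hV] at hex hra
  -- After scaling by `κ`, the two tuples of second coordinates differ by a cubic. The fifth element
  -- determines `κ` and the ratios $\Omega$ take care of the later ones; for $n=4$ any `κ` works,
  -- since four elements always lie on a cubic.
  obtain ⟨κ, hκ, hu⟩ : ∃ κ : ℂ, κ ≠ 0 ∧ ∀ k, 1 ≤ k → k ≤ n →
      entry (fun i => q.2 i - κ * p'.2 i) k
        = cubicInterp q.1 (fun i => q.2 i - κ * p'.2 i) (entry q.1 k) := by
    have hent : ∀ κ k, 1 ≤ k → k ≤ n →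
        entry (fun i => q.2 i - κ * p'.2 i) k = entry q.2 k - κ * entry p'.2 k :=
      fun κ k h1 h2 => by
        rw [entry_of_le _ h1 h2, entry_of_le _ h1 h2, entry_of_le _ h1 h2]
    by_cases h5 : 5 ≤ n
    · have h5' : excess q.1 p'.2 5 ≠ 0 := by
        rw [hex 5 le_rfl h5]
        exact mul_ne_zero (div_ne_zero
          (pow_ne_zero _ (DefinedAt.den_entry hh (by omega) (by omega)))
          (pow_ne_zero _ (PointParam.algebraMap_det_ne_zero _))) (hp5 h5)
      refine ⟨excess q.1 q.2 5 / excess q.1 p'.2 5, div_ne_zero (hq5 h5) h5', fun k h1 hk => ?_⟩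
      by_cases h4 : k ≤ 4
      · exact (cubicInterp_nodes hn hq _ h1 h4).symm
      · have hrel : excess q.1 q.2 k = excess q.1 q.2 5 / excess q.1 p'.2 5 * excess q.1 p'.2 k := by
          by_cases h6 : k = 5
          · rw [h6, div_mul_cancel₀ _ h5']
          · have e1 := hra k (by omega) hk
            rw [hΩ k (by omega) hk, div_eq_div_iff h5' (hq5 h5)] at e1
            rw [div_mul_eq_mul_div, eq_div_iff h5']
            linear_combination -e1
        have h3 := pow_ne_zero 3 (sub_ne_zero.2 (entry_ne hq (i := k) (j := 1) (by omega)
          (by omega) (by omega) (by omega) (by omega)))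
        generalize excess q.1 q.2 5 / excess q.1 p'.2 5 = κ at *
        rw [hent κ k h1 hk, cubicInterp_sub_mul hn]
        unfold excess at hrel
        rw [← mul_div_assoc, div_left_inj' h3] at hrel
        linear_combination hrel
    · refine ⟨1, one_ne_zero, fun k h1 hk => ?_⟩
      exact (cubicInterp_nodes hn hq _ h1 (by omega)).symm
  obtain ⟨A, B, C, D, hL⟩ := exists_lagrangeCubic_eq (entry q.1 1) (entry q.1 2) (entry q.1 3)
    (entry q.1 4) (entry (fun i => q.2 i - κ * p'.2 i) 1) (entry (fun i => q.2 i - κ * p'.2 i) 2)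
    (entry (fun i => q.2 i - κ * p'.2 i) 3) (entry (fun i => q.2 i - κ * p'.2 i) 4)
  have hu' : ∀ i, q.2 i = κ * ((a * d - b * c) * p.2 i / (c * p.1 i + d) ^ 3)
      + (A + B * q.1 i + C * q.1 i ^ 2 + D * q.1 i ^ 3) := by
    intro i
    have := hu (i + 1) (by omega) i.2
    rw [entry_succ, entry_succ] at this
    have h2 : cubicInterp q.1 (fun i => q.2 i - κ * p'.2 i) (q.1 i) = _ := hL (q.1 i)
    rw [h2, hW] at this
    linear_combination this
  -- Dividing the matrix by `κ` leaves $V$ unchanged and multiplies $(ad-bc)/(cv+d)^3$ by `κ`. The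
  -- other four parameters are the coefficients of $(A+BV+CV^2+DV^3)(cv+d)^3/\kappa^3$ as a cubic in
  -- $v$.
  refine ⟨⟨a / κ, b / κ, c / κ, d / κ,
    (A * d ^ 3 + B * b * d ^ 2 + C * b ^ 2 * d + D * b ^ 3) / κ ^ 3,
    (3 * A * c * d ^ 2 + B * (a * d ^ 2 + 2 * b * c * d) + C * (2 * a * b * d + b ^ 2 * c)
      + 3 * D * a * b ^ 2) / κ ^ 3,
    (3 * A * c ^ 2 * d + B * (2 * a * c * d + b * c ^ 2) + C * (a ^ 2 * d + 2 * a * b * c)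
      + 3 * D * a ^ 2 * b) / κ ^ 3,
    (A * c ^ 3 + B * a * c ^ 2 + C * a ^ 2 * c + D * a ^ 3) / κ ^ 3, ?_⟩, ?_, ?_⟩
  · have : a / κ * (d / κ) - b / κ * (c / κ) = (a * d - b * c) / κ ^ 2 := by ring
    rw [this]
    exact div_ne_zero hΔ (pow_ne_zero _ hκ)
  · intro i
    change c / κ * p.1 i + d / κ ≠ 0
    have : c / κ * p.1 i + d / κ = (c * p.1 i + d) / κ := by ring
    rw [this]
    exact div_ne_zero (hm i).1 hκ
  · have hq1 : ∀ i, q.1 i = (a * p.1 i + b) / (c * p.1 i + d) := fun i =>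
      (eq_div_iff (hm i).1).2 (hm i).2
    have hden : ∀ i, c / κ * p.1 i + d / κ = (c * p.1 i + d) / κ := fun i => by ring
    refine Prod.ext (funext fun i => ?_) (funext fun i => ?_)
    · change (a / κ * p.1 i + b / κ) / (c / κ * p.1 i + d / κ) = q.1 i
      rw [hden, hq1, div_div_eq_mul_div]
      congr 1
      field_simp
    · have hi := (hm i).1
      have hm2 := (hm i).2
      rw [hu']
      change (_ / κ ^ 3 + _ / κ ^ 3 * p.1 i + _ / κ ^ 3 * p.1 i ^ 2 + _ / κ ^ 3 * p.1 i ^ 3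
        + (a / κ * (d / κ) - b / κ * (c / κ)) * p.2 i) / (c / κ * p.1 i + d / κ) ^ 3 = _
      rw [hden, hq1]
      generalize hE : c * p.1 i + d = E at *
      generalize hN : a * p.1 i + b = N at *
      field_simp
      rw [← hE, ← hN]
      ring

theorem GenericElements.nondegenerate {p : (Fin n → ℂ) × (Fin n → ℂ)} (hp : GenericElements p) :
    Nondegenerate p := ⟨hp.1, hp.2.2⟩

theorem GenericElements.excess_ne_zero (hn : 4 ≤ n) {p : (Fin n → ℂ) × (Fin n → ℂ)}
    (hp : GenericElements p) (h5 : 5 ≤ n) : excess p.1 p.2 5 ≠ 0 := fun h =>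
  hp.2.1 h5 ((excess_eq_zero_iff hn hp.1 h5).1 h)

theorem exists_act_eq_of_fundInv_eq (hn : 4 ≤ n) {p q : (Fin n → ℂ) × (Fin n → ℂ)}
    (hp : GenericElements p) (hq : GenericElements q) (h : fundInv p = fundInv q) :
    ∃ g : PointParam, g.DefinedAt p ∧ g.act p = q := by
  refine exists_act_eq hn hp.1 hq.1 (hp.excess_ne_zero hn) (hq.excess_ne_zero hn)
    (fun j hj hjn => ?_) (fun l hl hln => ?_)
  · have := congrFun h (Sum.inl ⟨j - 4, by omega⟩)
    simpa only [fundInv, Nat.sub_add_cancel hj] using this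
  · have := congrFun h (Sum.inr ⟨l - 6, by omega⟩)
    rw [fundInv_inr hn hp.nondegenerate, fundInv_inr hn hq.nondegenerate] at this
    simpa only [Nat.sub_add_cancel hl] using this

theorem fundInv_isInvariantOn (hn : 4 ≤ n) (k : InvIndex n) :
    IsInvariantOn (fun p => fundInv p k) {p : (Fin n → ℂ) × (Fin n → ℂ) | GenericElements p} :=
  fun _ _ hp hg hgp => congrFun (fundInv_act hn hg hp.nondegenerate
    (GenericElements.nondegenerate hgp)) k

theorem isInvariantOn_iff (hn : 4 ≤ n) {D : Set ((Fin n → ℂ) × (Fin n → ℂ))}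
    (hD : ∀ p ∈ D, GenericElements p) (f : (Fin n → ℂ) × (Fin n → ℂ) → ℂ) :
    IsInvariantOn f D ↔ ∃ F : (InvIndex n → ℂ) → ℂ, ∀ p ∈ D, f p = F (fundInv p) := by
  classical
  constructor
  · intro h
    -- The chosen point of the fibre is immaterial, as a fibre of `fundInv` in `D` lies in one
    -- orbit; off the image the value is arbitrary.
    refine ⟨fun y => if hy : ∃ p ∈ D, fundInv p = y then f hy.choose else 0, fun p hp => ?_⟩
    have hy : ∃ q ∈ D, fundInv q = fundInv p := ⟨p, hp, rfl⟩
    simp only [dif_pos hy]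
    obtain ⟨hq, hqp⟩ := hy.choose_spec
    obtain ⟨g, hg, hgq⟩ := exists_act_eq_of_fundInv_eq hn (hD _ hq) (hD p hp) hqp
    have := h g _ hq hg (by rwa [hgq])
    rwa [hgq] at this
  · rintro ⟨F, hF⟩ g p hp hg hgp
    rw [hF p hp, hF _ hgp,
      fundInv_act hn hg (hD p hp).nondegenerate (hD _ hgp).nondegenerate]

end Orbits

/-! ### Holomorphy of the invariants and of the section; independence. -/

section Differentiability

variable {n : ℕ} {Z : Type*} [NormedAddCommGroup Z] [NormedSpace ℂ Z] {v w : Z → Fin n → ℂ} {z : Z}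

theorem _root_.DifferentiableAt.div_of_ne {f g : Z → ℂ} (hf : DifferentiableAt ℂ f z)
    (hg : DifferentiableAt ℂ g z) (h : g z ≠ 0) : DifferentiableAt ℂ (fun x => f x / g x) z := by
  simp only [div_eq_mul_inv]
  exact hf.mul (hg.inv h)

theorem differentiableAt_entry (hv : DifferentiableAt ℂ v z) (k : ℕ) :
    DifferentiableAt ℂ (fun x => entry (v x) k) z := by
  unfold entry
  split_ifs with h
  · exact differentiableAt_pi.1 hv _
  · exact differentiableAt_const _

theorem differentiableAt_diffRatio (hv : DifferentiableAt ℂ v z) (h : entry (v z) 2 ≠ entry (v z) 1)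
    (k : ℕ) : DifferentiableAt ℂ (fun x => diffRatio (v x) k) z := by
  refine ((differentiableAt_entry hv k).sub (differentiableAt_entry hv 1)).div_of_ne
    ((differentiableAt_entry hv 2).sub (differentiableAt_entry hv 1)) ?_
  exact sub_ne_zero.2 h

theorem diffRatio_ne_zero {K : Type*} [Field K] {x : Fin n → K} (h : entry x 2 ≠ entry x 1) {k : ℕ}
    (hk : entry x k ≠ entry x 1) : diffRatio x k ≠ 0 :=
  div_ne_zero (sub_ne_zero.2 hk) (sub_ne_zero.2 h)

theorem diffRatio_ne_one {K : Type*} [Field K] {x : Fin n → K} (h : entry x 2 ≠ entry x 1) {k : ℕ}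
    (hk : entry x k ≠ entry x 2) : diffRatio x k ≠ 1 := by
  unfold diffRatio
  rw [ne_eq, div_eq_one_iff_eq (sub_ne_zero.2 h)]
  exact fun h' => hk (sub_left_injective h')

theorem differentiableAt_r (hn : 4 ≤ n) (hv : DifferentiableAt ℂ v z)
    (hz : Function.Injective (v z)) {k : ℕ} (hk : 4 ≤ k) (hkn : k ≤ n) :
    DifferentiableAt ℂ (fun x => r (v x) k) z := by
  have h2 : entry (v z) 2 ≠ entry (v z) 1 :=
    entry_ne hz (by omega) (by omega) (by omega) (by omega) (by omega)
  refine ((differentiableAt_diffRatio hv h2 3).mul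
    ((differentiableAt_diffRatio hv h2 k).sub_const 1)).div_of_ne
    ((differentiableAt_diffRatio hv h2 k).mul ((differentiableAt_diffRatio hv h2 3).sub_const 1)) ?_
  refine mul_ne_zero (diffRatio_ne_zero h2 ?_) (sub_ne_zero.2 (diffRatio_ne_one h2 ?_))
  all_goals exact entry_ne hz (by omega) (by omega) (by omega) (by omega) (by omega)

theorem differentiableAt_s (hn : 4 ≤ n) (hv : DifferentiableAt ℂ v z) (hw : DifferentiableAt ℂ w z)
    (hz : Function.Injective (v z)) (h2w : entry (w z) 2 ≠ entry (w z) 1)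
    {k : ℕ} (hk : 3 ≤ k) (hkn : k ≤ n) :
    DifferentiableAt ℂ (fun x => s (v x) (w x) k) z := by
  have h2 : entry (v z) 2 ≠ entry (v z) 1 :=
    entry_ne hz (by omega) (by omega) (by omega) (by omega) (by omega)
  refine (differentiableAt_diffRatio hw h2w k).div_of_ne ((differentiableAt_diffRatio hv h2 k).pow 3) ?_
  refine pow_ne_zero _ (diffRatio_ne_zero h2 ?_)
  exact entry_ne hz (by omega) (by omega) (by omega) (by omega) (by omega)

theorem differentiableAt_sigma (hn : 4 ≤ n) (hv : DifferentiableAt ℂ v z)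
    (hw : DifferentiableAt ℂ w z)
    (hz : Function.Injective (v z)) (h2w : entry (w z) 2 ≠ entry (w z) 1)
    (hs : s (v z) (w z) 3 ≠ 1) {k : ℕ} (hk : 3 ≤ k) (hkn : k ≤ n) :
    DifferentiableAt ℂ (fun x => sigma (v x) (w x) k) z := by
  refine ((differentiableAt_s hn hv hw hz h2w hk hkn).sub_const 1).div_of_ne
    ((differentiableAt_s hn hv hw hz h2w le_rfl (by omega)).sub_const 1) ?_
  exact sub_ne_zero.2 hs

theorem differentiableAt_omegaNum (hn : 4 ≤ n) (hv : DifferentiableAt ℂ v z)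
    (hw : DifferentiableAt ℂ w z)
    (hz : Function.Injective (v z)) (h2w : entry (w z) 2 ≠ entry (w z) 1)
    (hs : s (v z) (w z) 3 ≠ 1) (hσ : sigma (v z) (w z) 4 ≠ r (v z) 4)
    {k : ℕ} (hk : 4 ≤ k) (hkn : k ≤ n) :
    DifferentiableAt ℂ (fun x => omegaNum (v x) (w x) k) z := by
  have h4 := differentiableAt_r hn hv hz (k := 4) le_rfl hn
  have h4' := differentiableAt_sigma hn hv hw hz h2w hs (k := 4) (by omega) hn
  have hk1 := differentiableAt_r hn hv hz hk hkn
  have hk2 := differentiableAt_sigma hn hv hw hz h2w hs (k := k) (by omega) hkn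
  refine (((h4.pow 2).sub h4).mul ((hk2.sub hk1).div_of_ne (h4'.sub h4) ?_)).sub
    ((hk1.pow 2).sub hk1)
  exact sub_ne_zero.2 hσ

theorem differentiableAt_fundInv_comp (hn : 4 ≤ n) (hv : DifferentiableAt ℂ v z)
    (hw : DifferentiableAt ℂ w z) (hz : Nondegenerate (v z, w z)) :
    DifferentiableAt ℂ (fun x => fundInv (v x, w x)) z := by
  refine differentiableAt_pi.2 ?_
  rintro (j | l)
  · exact differentiableAt_r hn hv hz.1 (by omega) (by omega)
  · obtain ⟨h1, h2, h3, h4⟩ := hz.2 (by have := l.2; omega)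
    refine (differentiableAt_omegaNum hn hv hw hz.1 h1 h2 h3 (by omega) (by omega)).div_of_ne
      (differentiableAt_omegaNum hn hv hw hz.1 h1 h2 h3 (by omega)
        (by have := l.2; omega)) ?_
    exact h4

theorem differentiableAt_fundInv (hn : 4 ≤ n) {q : (Fin n → ℂ) × (Fin n → ℂ)}
    (hq : Nondegenerate q) : DifferentiableAt ℂ (fundInv (n := n) (K := ℂ)) q :=
  differentiableAt_fundInv_comp hn differentiableAt_fst differentiableAt_snd hq

theorem differentiableAt_cubicInterp {f : Z → ℂ} (hn : 4 ≤ n) (hv : DifferentiableAt ℂ v z)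
    (hw : DifferentiableAt ℂ w z) (hf : DifferentiableAt ℂ f z) (hz : Function.Injective (v z)) :
    DifferentiableAt ℂ (fun x => cubicInterp (v x) (w x) (f x)) z := by
  have e := fun k => differentiableAt_entry hv k
  have e' := fun k => differentiableAt_entry hw k
  have ne : ∀ {i j : ℕ}, 1 ≤ i → i ≤ 4 → 1 ≤ j → j ≤ 4 → i ≠ j →
      entry (v z) i - entry (v z) j ≠ 0 := fun h1 h2 h3 h4 h5 =>
    sub_ne_zero.2 (entry_ne hz h1 (h2.trans hn) h3 (h4.trans hn) h5)
  have hterm : ∀ (i a b c : ℕ), 1 ≤ i → i ≤ 4 → 1 ≤ a → a ≤ 4 → 1 ≤ b → b ≤ 4 → 1 ≤ c → c ≤ 4 →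
      i ≠ a → i ≠ b → i ≠ c → DifferentiableAt ℂ (fun x => entry (w x) i /
        ((entry (v x) i - entry (v x) a) * (entry (v x) i - entry (v x) b)
          * (entry (v x) i - entry (v x) c)) *
        ((f x - entry (v x) a) * (f x - entry (v x) b) * (f x - entry (v x) c))) z := by
    intro i a b c i1 i2 a1 a2 b1 b2 c1 c2 ha hb hc
    refine ((e' i).div_of_ne ((((e i).sub (e a)).mul ((e i).sub (e b))).mul ((e i).sub (e c))) ?_).mul
      (((hf.sub (e a)).mul (hf.sub (e b))).mul (hf.sub (e c)))
    exact mul_ne_zero (mul_ne_zero (ne i1 i2 a1 a2 ha) (ne i1 i2 b1 b2 hb)) (ne i1 i2 c1 c2 hc)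
  exact (((hterm 1 2 3 4 (by omega) (by omega) (by omega) (by omega) (by omega) (by omega)
    (by omega) (by omega) (by omega) (by omega) (by omega)).add
    (hterm 2 1 3 4 (by omega) (by omega) (by omega) (by omega) (by omega) (by omega)
    (by omega) (by omega) (by omega) (by omega) (by omega))).add
    (hterm 3 1 2 4 (by omega) (by omega) (by omega) (by omega) (by omega) (by omega)
    (by omega) (by omega) (by omega) (by omega) (by omega))).add
    (hterm 4 1 2 3 (by omega) (by omega) (by omega) (by omega) (by omega) (by omega)
    (by omega) (by omega) (by omega) (by omega) (by omega))

theorem differentiableAt_excess (hn : 4 ≤ n) (hv : DifferentiableAt ℂ v z)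
    (hw : DifferentiableAt ℂ w z) (hz : Function.Injective (v z)) {k : ℕ} (hk : 5 ≤ k)
    (hkn : k ≤ n) : DifferentiableAt ℂ (fun x => excess (v x) (w x) k) z := by
  refine ((differentiableAt_entry hw k).sub (differentiableAt_cubicInterp hn hv hw
    (differentiableAt_entry hv k) hz)).div_of_ne
    (((differentiableAt_entry hv k).sub (differentiableAt_entry hv 1)).pow 3) ?_
  exact pow_ne_zero _ (sub_ne_zero.2 (entry_ne hz (by omega) (by omega) (by omega)
    (by omega) (by omega)))

/-- The reconstruction depends holomorphically on the tuple and the values of the invariants. -/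
theorem differentiableAt_reconstruct (hn : 4 ≤ n)
    {z : ((Fin n → ℂ) × (Fin n → ℂ)) × (InvIndex n → ℂ)} (hz : Reconstructible z.1 z.2) :
    DifferentiableAt ℂ (fun x : ((Fin n → ℂ) × (Fin n → ℂ)) × (InvIndex n → ℂ) =>
      reconstruct x.1 x.2) z := by
  have h1 : DifferentiableAt ℂ (fun x : ((Fin n → ℂ) × (Fin n → ℂ)) × (InvIndex n → ℂ) =>
      x.1.1) z := differentiableAt_fst.comp z differentiableAt_fst
  have h2 : DifferentiableAt ℂ (fun x : ((Fin n → ℂ) × (Fin n → ℂ)) × (InvIndex n → ℂ) =>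
      x.1.2) z := differentiableAt_snd.comp z differentiableAt_fst
  have hy : ∀ k, DifferentiableAt ℂ (fun x : ((Fin n → ℂ) × (Fin n → ℂ)) × (InvIndex n → ℂ) =>
      x.2 k) z := differentiableAt_pi.1 differentiableAt_snd
  have e := fun k => differentiableAt_entry h1 k
  have hV : DifferentiableAt ℂ (fun x : ((Fin n → ℂ) × (Fin n → ℂ)) × (InvIndex n → ℂ) =>
      reconstructV x.1.1 x.2) z := by
    refine differentiableAt_pi.2 fun i => ?_
    unfold reconstructV
    split_ifs with h
    · refine ((((hy _).mul ((e 3).sub (e 2))).mul (e 1)).sub (((e 3).sub (e 1)).mul (e 2))).div_of_ne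
        (((hy _).mul ((e 3).sub (e 2))).sub ((e 3).sub (e 1))) ?_
      exact hz.1 _
    · exact differentiableAt_pi.1 h1 i
  have hVi := differentiableAt_pi.1 hV
  refine DifferentiableAt.prodMk hV (differentiableAt_pi.2 fun i => ?_)
  unfold reconstructW
  split_ifs with h
  · exact (differentiableAt_cubicInterp hn hV h2 (hVi i) hz.2.1).add
      (((hy _).mul (differentiableAt_excess hn hV h2 hz.2.1 le_rfl (by omega))).mul
        (((hVi i).sub (differentiableAt_entry hV 1)).pow 3))
  · exact differentiableAt_pi.1 h2 i

/-- Each nonvanishing condition is open because the preceding ones make its expression continuous at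
`q`. -/
theorem eventually_nondegenerate (hn : 4 ≤ n) {q : (Fin n → ℂ) × (Fin n → ℂ)}
    (hq : Nondegenerate q) : ∀ᶠ p in 𝓝 q, Nondegenerate p := by
  have d1 : DifferentiableAt ℂ (fun p : (Fin n → ℂ) × (Fin n → ℂ) => p.1) q := differentiableAt_fst
  have d2 : DifferentiableAt ℂ (fun p : (Fin n → ℂ) × (Fin n → ℂ) => p.2) q := differentiableAt_snd
  have h1 : ∀ᶠ p in 𝓝 q, Function.Injective p.1 := by
    have : ∀ i j : Fin n, ∀ᶠ p in 𝓝 q, p.1 i = p.1 j → i = j := by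
      intro i j
      by_cases hij : i = j
      · exact Eventually.of_forall fun p _ => hij
      · have hne := (ContinuousAt.sub (differentiableAt_pi.1 d1 i).continuousAt
          (differentiableAt_pi.1 d1 j).continuousAt).eventually_ne
          (sub_ne_zero.2 fun h => hij (hq.1 h))
        filter_upwards [hne] with p hp h using absurd h (sub_ne_zero.1 hp)
    filter_upwards [eventually_all.2 fun i => eventually_all.2 (this i)] with p hp i j h
      using hp i j h
  by_cases h6 : 6 ≤ n
  · obtain ⟨g1, g2, g3, g4⟩ := hq.2 h6
    have c1 := (ContinuousAt.sub (differentiableAt_entry d2 2).continuousAt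
      (differentiableAt_entry d2 1).continuousAt).eventually_ne (sub_ne_zero.2 g1)
    have c2 := (differentiableAt_s hn d1 d2 hq.1 g1 (k := 3) le_rfl
      (by omega)).continuousAt.eventually_ne g2
    have c3 := (ContinuousAt.sub (differentiableAt_sigma hn d1 d2 hq.1 g1 g2 (k := 4) (by omega)
      hn).continuousAt (differentiableAt_r hn d1 hq.1 (k := 4) le_rfl
      hn).continuousAt).eventually_ne (sub_ne_zero.2 g3)
    have c4 := (differentiableAt_omegaNum hn d1 d2 hq.1 g1 g2 g3 (k := 5) (by omega)
      (by omega)).continuousAt.eventually_ne g4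
    filter_upwards [h1, c1, c2, c3, c4] with p k1 k2 k3 k4 k5 using
      ⟨k1, fun _ => ⟨sub_ne_zero.1 k2, k3, sub_ne_zero.1 k4, k5⟩⟩
  · filter_upwards [h1] with p hp using ⟨hp, fun h => absurd h h6⟩

theorem eventually_genericElements (hn : 4 ≤ n) {q : (Fin n → ℂ) × (Fin n → ℂ)}
    (hq : GenericElements q) : ∀ᶠ p in 𝓝 q, GenericElements p := by
  have h1 := eventually_nondegenerate hn hq.nondegenerate
  by_cases h5 : 5 ≤ n
  · have c := (differentiableAt_excess hn (v := fun p : (Fin n → ℂ) × (Fin n → ℂ) => p.1)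
      (w := fun p => p.2) differentiableAt_fst differentiableAt_snd hq.1 le_rfl
      h5).continuousAt.eventually_ne (hq.excess_ne_zero hn h5)
    filter_upwards [h1, c] with p k1 k2 using
      ⟨k1.1, fun _ h => k2 ((excess_eq_zero_iff hn k1.1 h5).2 h), k1.2⟩
  · filter_upwards [h1] with p k1 using ⟨k1.1, fun h => absurd h h5, k1.2⟩

theorem eventually_reconstructible (hn : 4 ≤ n) {q : (Fin n → ℂ) × (Fin n → ℂ)}
    (hq : Nondegenerate q) : ∀ᶠ z : ((Fin n → ℂ) × (Fin n → ℂ)) × (InvIndex n → ℂ) in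
      𝓝 (q, fundInv q), Reconstructible z.1 z.2 := by
  have hz := reconstructible_fundInv hn hq
  have hc := (differentiableAt_reconstruct hn (z := (q, fundInv q)) hz).continuousAt
  have h1 : DifferentiableAt ℂ (fun x : ((Fin n → ℂ) × (Fin n → ℂ)) × (InvIndex n → ℂ) =>
      x.1.1) (q, fundInv q) := differentiableAt_fst.comp _ differentiableAt_fst
  have hy : ∀ k, DifferentiableAt ℂ (fun x : ((Fin n → ℂ) × (Fin n → ℂ)) × (InvIndex n → ℂ) =>
      x.2 k) (q, fundInv q) := differentiableAt_pi.1 differentiableAt_snd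
  have e := fun k => differentiableAt_entry h1 k
  have hd : ∀ j : Fin (n - 3), _ := fun j =>
    (((hy (Sum.inl j)).mul ((e 3).sub (e 2))).sub ((e 3).sub (e 1))).continuousAt.eventually_ne
      (hz.1 j)
  have hN : ∀ᶠ p in 𝓝 (reconstruct q (fundInv q)), Nondegenerate p :=
    eventually_nondegenerate hn hz.2
  filter_upwards [eventually_all.2 hd, hc.eventually hN] with z k1 k2 using ⟨k1, k2⟩

/-- The differentials of the invariants are linearly independent. -/
theorem linearIndependent_fderiv_fundInv (hn : 4 ≤ n) {p : (Fin n → ℂ) × (Fin n → ℂ)}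
    (hp : Nondegenerate p) : LinearIndependent ℂ (fun k : InvIndex n =>
      fderiv ℂ (fun q : (Fin n → ℂ) × (Fin n → ℂ) => fundInv q k) p) := by
  have hI := differentiableAt_fundInv hn hp
  have hR := differentiableAt_reconstruct hn (z := (p, fundInv p)) (reconstructible_fundInv hn hp)
  have hS : DifferentiableAt ℂ (fun y => reconstruct p y) (fundInv p) :=
    DifferentiableAt.comp (fundInv p) (f := fun y => (p, y)) hR
      ((differentiableAt_const p).prodMk differentiableAt_id)
  have hI' : DifferentiableAt ℂ (fundInv (n := n) (K := ℂ)) (reconstruct p (fundInv p)) := by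
    rwa [reconstruct_fundInv hn hp]
  have hcont : ContinuousAt (fun y : InvIndex n → ℂ => (p, y)) (fundInv p) := by fun_prop
  have hev : (fun y => fundInv (reconstruct p y)) =ᶠ[𝓝 (fundInv p)] id := by
    filter_upwards [hcont.eventually (eventually_reconstructible hn hp)] with y hy
      using fundInv_reconstruct hn hy
  -- The section is a local right inverse of `fundInv`, so its differential is a right inverse of
  -- the differential of `fundInv`; its values on the basis vectors separate the differentials of
  -- the invariants.
  have hid : (fderiv ℂ fundInv p).comp (fderiv ℂ (fun y => reconstruct p y) (fundInv p))
      = ContinuousLinearMap.id ℂ (InvIndex n → ℂ) := by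
    have h1 := fderiv_comp (fundInv p) hI' hS
    rw [reconstruct_fundInv hn hp] at h1
    rw [← h1]
    exact hev.fderiv_eq.trans fderiv_id
  have hk : ∀ k, fderiv ℂ (fun q : (Fin n → ℂ) × (Fin n → ℂ) => fundInv q k) p
      = (ContinuousLinearMap.proj k).comp (fderiv ℂ fundInv p) := fun k => by
    rw [fderiv_apply hI k]
  rw [Fintype.linearIndependent_iff]
  intro c hc k
  have h1 := congrArg (fun T => T (fderiv ℂ (fun y => reconstruct p y) (fundInv p)
    (Pi.single k 1))) hc
  have h2 : fderiv ℂ fundInv p (fderiv ℂ (fun y => reconstruct p y) (fundInv p)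
    (Pi.single k 1)) = Pi.single k 1 := congrArg (fun T => T (Pi.single k 1)) hid
  have h3 : ∑ i, c i * (Pi.single k 1 : InvIndex n → ℂ) i = 0 := by
    simpa [hk, h2, -Fintype.sum_sum_type] using h1
  simpa [Pi.single_apply, -Fintype.sum_sum_type] using h3

end Differentiability

/-! ### Infinitesimal generators and local holomorphic invariants. -/

section Infinitesimal

variable {n : ℕ}

/-- The general linear combination of the infinitesimal generators. -/
def generatorField (α β γ κ A B C D : ℂ) (p : (Fin n → ℂ) × (Fin n → ℂ)) :
    (Fin n → ℂ) × (Fin n → ℂ) :=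
  (fun i => α + β * p.1 i + γ * p.1 i ^ 2,
   fun i => κ * p.2 i + 3 * γ * p.1 i * p.2 i
      + (A + B * p.1 i + C * p.1 i ^ 2 + D * p.1 i ^ 3))

theorem fderiv_eq_sum_partial (f : (Fin n → ℂ) × (Fin n → ℂ) → ℂ)
    (p u : (Fin n → ℂ) × (Fin n → ℂ)) :
    fderiv ℂ f p u = ∑ k, (u.1 k * partialV f k p + u.2 k * partialW f k p) := by
  have hu : u = ∑ k, (u.1 k • ((Pi.single k 1, 0) : (Fin n → ℂ) × (Fin n → ℂ))
      + u.2 k • ((0, Pi.single k 1) : (Fin n → ℂ) × (Fin n → ℂ))) := by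
    refine Prod.ext (funext fun i => ?_) (funext fun i => ?_)
    · simp [Prod.fst_sum, Pi.single_apply]
    · simp [Prod.snd_sum, Pi.single_apply]
  conv_lhs => rw [hu]
  simp only [map_sum, map_add, map_smul, smul_eq_mul]
  rfl

theorem isInfinitesimallyInvariantAt_iff (f : (Fin n → ℂ) × (Fin n → ℂ) → ℂ)
    (p : (Fin n → ℂ) × (Fin n → ℂ)) : IsInfinitesimallyInvariantAt f p ↔
      ∀ α β γ κ A B C D : ℂ, fderiv ℂ f p (generatorField α β γ κ A B C D p) = 0 := by
  simp only [fderiv_eq_sum_partial, generatorField]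
  constructor
  · rintro ⟨h1, h2, h3, h4, h5, h6, h7, h8⟩ α β γ κ A B C D
    have : ∑ k, ((α + β * p.1 k + γ * p.1 k ^ 2) * partialV f k p
        + (κ * p.2 k + 3 * γ * p.1 k * p.2 k
          + (A + B * p.1 k + C * p.1 k ^ 2 + D * p.1 k ^ 3)) * partialW f k p)
        = α * ∑ k, partialV f k p + A * ∑ k, partialW f k p + β * ∑ k, p.1 k * partialV f k p
          + κ * ∑ k, p.2 k * partialW f k p
          + γ * ∑ k, (p.1 k ^ 2 * partialV f k p + 3 * p.1 k * p.2 k * partialW f k p)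
          + B * ∑ k, p.1 k * partialW f k p + C * ∑ k, p.1 k ^ 2 * partialW f k p
          + D * ∑ k, p.1 k ^ 3 * partialW f k p := by
      simp only [Finset.mul_sum, ← Finset.sum_add_distrib]
      exact Finset.sum_congr rfl fun k _ => by ring
    rw [this, h1, h2, h3, h4, h5, h6, h7, h8]
    ring
  · intro h
    refine ⟨?_, ?_, ?_, ?_, ?_, ?_, ?_, ?_⟩
    · simpa using h 1 0 0 0 0 0 0 0
    · simpa using h 0 0 0 0 1 0 0 0
    · simpa using h 0 1 0 0 0 0 0 0
    · simpa using h 0 0 0 1 0 0 0 0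
    · simpa using h 0 0 1 0 0 0 0 0
    · simpa using h 0 0 0 0 0 1 0 0
    · simpa using h 0 0 0 0 0 0 1 0
    · simpa using h 0 0 0 0 0 0 0 1

/-- The generators annihilate the invariants. -/
theorem fderiv_fundInv_generatorField (hn : 4 ≤ n) {p : (Fin n → ℂ) × (Fin n → ℂ)}
    (hp : Nondegenerate p) (α β γ κ A B C D : ℂ) :
    fderiv ℂ fundInv p (generatorField α β γ κ A B C D p) = 0 := by
  -- The orbit of `p` along a curve of group elements through the identity. At $t=0$ its velocity is
  -- `generatorField`: the coefficients $2\beta-\kappa$ and $\beta-\kappa$ solve $a'-d'=\beta$,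
  -- $a'-2d'=\kappa$.
  set ψ : ℂ → (Fin n → ℂ) × (Fin n → ℂ) := fun t =>
    (fun i => ((1 + t * (2 * β - κ)) * p.1 i + t * α) / (-(t * γ) * p.1 i + (1 + t * (β - κ))),
     fun i => (t * A + t * B * p.1 i + t * C * p.1 i ^ 2 + t * D * p.1 i ^ 3
      + ((1 + t * (2 * β - κ)) * (1 + t * (β - κ)) - t * α * (-(t * γ))) * p.2 i)
        / (-(t * γ) * p.1 i + (1 + t * (β - κ))) ^ 3) with hψ
  have hψ0 : ψ 0 = p := by simp [hψ]
  have hlin : ∀ a : ℂ, HasDerivAt (fun t : ℂ => t * a) a 0 := fun a => by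
    simpa using (hasDerivAt_id (0 : ℂ)).mul_const a
  have hden : ∀ i, HasDerivAt (fun t : ℂ => -(t * γ) * p.1 i + (1 + t * (β - κ)))
      (-γ * p.1 i + (β - κ)) 0 := fun i => by
    exact ((hlin γ).neg.mul_const (p.1 i)).add ((hlin (β - κ)).const_add 1)
  have hdet : HasDerivAt (fun t : ℂ => (1 + t * (2 * β - κ)) * (1 + t * (β - κ))
      - t * α * (-(t * γ))) ((2 * β - κ) + (β - κ)) 0 := by
    have := (((hlin (2 * β - κ)).const_add 1).mul ((hlin (β - κ)).const_add 1)).sub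
      ((hlin α).mul (hlin γ).neg)
    refine this.congr_deriv ?_
    simp
  have hderiv : HasDerivAt ψ (generatorField α β γ κ A B C D p) 0 := by
    refine HasDerivAt.prodMk (hasDerivAt_pi.2 fun i => ?_) (hasDerivAt_pi.2 fun i => ?_)
    · have := ((((hlin (2 * β - κ)).const_add 1).mul_const (p.1 i)).add (hlin α)).div (hden i)
        (by simp)
      refine this.congr_deriv ?_
      simp
      ring
    · have := ((((((hlin A).add ((hlin B).mul_const (p.1 i))).add
        ((hlin C).mul_const (p.1 i ^ 2))).add ((hlin D).mul_const (p.1 i ^ 3))).add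
        (hdet.mul_const (p.2 i)))).div ((hden i).pow 3) (by simp)
      refine this.congr_deriv ?_
      simp
      ring
  have hI : HasFDerivAt (fundInv (n := n) (K := ℂ)) (fderiv ℂ fundInv p) (ψ 0) := by
    rw [hψ0]; exact (differentiableAt_fundInv hn hp).hasFDerivAt
  have hev : (fun t => fundInv (ψ t)) =ᶠ[𝓝 0] fun _ => fundInv p := by
    have h1 : ∀ᶠ t in 𝓝 (0 : ℂ), Nondegenerate (ψ t) :=
      hderiv.continuousAt.eventually (by rw [hψ0]; exact eventually_nondegenerate hn hp)
    have h2 := hdet.continuousAt.eventually_ne (y := 0) (by simp)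
    have h3 := eventually_all.2 fun i => (hden i).continuousAt.eventually_ne (y := 0) (by simp)
    filter_upwards [h1, h2, h3] with t h1 h2 h3
    exact fundInv_act (g := ⟨1 + t * (2 * β - κ), t * α, -(t * γ), 1 + t * (β - κ),
      t * A, t * B, t * C, t * D, h2⟩) hn h3 hp h1
  have h1 := hI.comp_hasDerivAt 0 hderiv
  exact h1.unique ((hasDerivAt_const (0 : ℂ) (fundInv p)).congr_of_eventuallyEq hev)

theorem exists_quadratic {a b c : ℂ} (hab : a ≠ b) (hac : a ≠ c) (hbc : b ≠ c) (x y z : ℂ) :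
    ∃ α β γ : ℂ, α + β * a + γ * a ^ 2 = x ∧ α + β * b + γ * b ^ 2 = y ∧
      α + β * c + γ * c ^ 2 = z := by
  have h1 := sub_ne_zero.2 hab
  have h2 := sub_ne_zero.2 hac
  have h3 := sub_ne_zero.2 hbc
  refine ⟨x - (x - y) / (a - b) * a
      + ((x - y) / (a - b) - (x - z) / (a - c)) / (b - c) * (a * b),
    (x - y) / (a - b) - ((x - y) / (a - b) - (x - z) / (a - c)) / (b - c) * (a + b),
    ((x - y) / (a - b) - (x - z) / (a - c)) / (b - c), ?_, ?_, ?_⟩ <;>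
  field_simp <;> ring

/-- A tangent vector annihilated by the differentials of the invariants is a combination of the
generators. -/
theorem exists_generatorField_eq (hn : 4 ≤ n) {p : (Fin n → ℂ) × (Fin n → ℂ)}
    (hp : GenericElements p) {u : (Fin n → ℂ) × (Fin n → ℂ)} (hu : fderiv ℂ fundInv p u = 0) :
    ∃ α β γ κ A B C D : ℂ, u = generatorField α β γ κ A B C D p := by
  have hN := hp.nondegenerate
  -- Along such an `x`, `p + t • x` is the reconstruction from the fixed base `p` and the invariants
  -- of `p + t • x`, which are stationary at $t=0$; hence its velocity `x` is zero.
  have hrigid : ∀ x : (Fin n → ℂ) × (Fin n → ℂ), fderiv ℂ fundInv p x = 0 →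
      (∀ i : Fin n, (i : ℕ) < 3 → x.1 i = 0) → (∀ i : Fin n, (i : ℕ) < 5 → x.2 i = 0) → x = 0 := by
    intro x hx hx1 hx2
    have hI := differentiableAt_fundInv hn hN
    have hR := differentiableAt_reconstruct hn (z := (p, fundInv p)) (reconstructible_fundInv hn hN)
    have hx3 : HasDerivAt (fun t : ℂ => p + t • x) x 0 := by
      simpa using ((hasDerivAt_id (0 : ℂ)).smul_const x).const_add p
    have hI2 : HasDerivAt (fun t : ℂ => fundInv (p + t • x)) 0 0 := by
      have h1 : HasFDerivAt (fundInv (n := n) (K := ℂ)) (fderiv ℂ fundInv p) (p + (0 : ℂ) • x) := by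
        simpa using hI.hasFDerivAt
      have := h1.comp_hasDerivAt 0 hx3
      rwa [hx] at this
    have hconst : HasDerivAt (fun _ : ℂ => p) (0 : (Fin n → ℂ) × (Fin n → ℂ)) (0 : ℂ) :=
      hasDerivAt_const _ _
    have hR' : HasFDerivAt (fun x : ((Fin n → ℂ) × (Fin n → ℂ)) × (InvIndex n → ℂ) =>
      reconstruct x.1 x.2) (fderiv ℂ (fun x : ((Fin n → ℂ) × (Fin n → ℂ)) × (InvIndex n → ℂ) =>
      reconstruct x.1 x.2) (p, fundInv p)) (p, fundInv (p + (0 : ℂ) • x)) := by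
      simpa using hR.hasFDerivAt
    have h2 := hR'.comp_hasDerivAt (0 : ℂ) (hconst.prodMk hI2)
    have hev : ((fun x : ((Fin n → ℂ) × (Fin n → ℂ)) × (InvIndex n → ℂ) =>
        reconstruct x.1 x.2) ∘ fun t : ℂ => (p, fundInv (p + t • x)))
        =ᶠ[𝓝 0] fun t => p + t • x := by
      have h1 : ∀ᶠ t in 𝓝 (0 : ℂ), Nondegenerate (p + t • x) :=
        hx3.continuousAt.eventually (by simpa using eventually_nondegenerate hn hN)
      filter_upwards [h1] with t ht
      change reconstruct p (fundInv (p + t • x)) = p + t • x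
      conv_rhs => rw [← reconstruct_fundInv hn ht]
      exact reconstruct_congr (fun i hi => by simp [hx1 i hi]) (fun i hi => by simp [hx2 i hi]) _
    have h3 := (h2.congr_of_eventuallyEq hev.symm).unique hx3
    rw [← h3]
    exact map_zero _
  have ne : ∀ {i j : ℕ}, 1 ≤ i → i ≤ n → 1 ≤ j → j ≤ n → i ≠ j →
      entry p.1 i ≠ entry p.1 j := fun h1 h2 h3 h4 h5 => entry_ne hp.1 h1 h2 h3 h4 h5
  obtain ⟨α, β, γ, h1, h2, h3⟩ := exists_quadratic
    (ne (i := 1) (j := 2) (by omega) (by omega) (by omega) (by omega) (by omega))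
    (ne (i := 1) (j := 3) (by omega) (by omega) (by omega) (by omega) (by omega))
    (ne (i := 2) (j := 3) (by omega) (by omega) (by omega) (by omega) (by omega))
    (entry u.1 1) (entry u.1 2) (entry u.1 3)
  obtain ⟨κ, A, B, C, D, h4⟩ : ∃ κ A B C D : ℂ, ∀ i : Fin n, (i : ℕ) < 5 →
      u.2 i = κ * p.2 i + 3 * γ * p.1 i * p.2 i
      + (A + B * p.1 i + C * p.1 i ^ 2 + D * p.1 i ^ 3) := by
    set x : Fin n → ℂ := fun i => u.2 i - 3 * γ * p.1 i * p.2 i with hx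
    obtain ⟨κ, hκ⟩ : ∃ κ : ℂ, ∀ k, 1 ≤ k → k ≤ n → k ≤ 5 →
        entry (fun i => x i - κ * p.2 i) k
          = cubicInterp p.1 (fun i => x i - κ * p.2 i) (entry p.1 k) := by
      -- Four values are met by a cubic; `κ` adjusts the fifth, where genericity gives a nonzero
      -- divisor. For $n=4$ there is no fifth value and `κ` is immaterial.
      refine ⟨excess p.1 x 5 / excess p.1 p.2 5, fun k k1 k2 k3 => ?_⟩
      by_cases k4 : k ≤ 4
      · exact (cubicInterp_nodes hn hp.1 _ k1 k4).symm
      · obtain rfl : k = 5 := by omega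
        have h5 := hp.excess_ne_zero hn k2
        have hrel : excess p.1 x 5 = excess p.1 x 5 / excess p.1 p.2 5 * excess p.1 p.2 5 :=
          (div_mul_cancel₀ _ h5).symm
        have h0 := pow_ne_zero 3 (sub_ne_zero.2 (ne (i := 5) (j := 1) (by omega)
          (by omega) (by omega) (by omega) (by omega)))
        generalize excess p.1 x 5 / excess p.1 p.2 5 = κ at *
        rw [cubicInterp_sub_mul hn, entry_of_le _ k1 k2]
        unfold excess at hrel
        rw [← mul_div_assoc, div_left_inj' h0, entry_of_le x k1 k2, entry_of_le p.2 k1 k2] at hrel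
        linear_combination hrel
    obtain ⟨A, B, C, D, hL⟩ := exists_lagrangeCubic_eq (entry p.1 1) (entry p.1 2) (entry p.1 3)
      (entry p.1 4) (entry (fun i => x i - κ * p.2 i) 1) (entry (fun i => x i - κ * p.2 i) 2)
      (entry (fun i => x i - κ * p.2 i) 3) (entry (fun i => x i - κ * p.2 i) 4)
    refine ⟨κ, A, B, C, D, fun i hi => ?_⟩
    have := hκ (i + 1) (by omega) i.2 (by omega)
    rw [entry_succ, entry_succ] at this
    have h2 : cubicInterp p.1 (fun i => x i - κ * p.2 i) (p.1 i) = _ := hL (p.1 i)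
    rw [h2, hx] at this
    linear_combination this
  refine ⟨α, β, γ, κ, A, B, C, D, ?_⟩
  rw [← sub_eq_zero]
  refine hrigid _ ?_ (fun i hi => ?_) (fun i hi => ?_)
  · rw [map_sub, hu, fderiv_fundInv_generatorField hn hN, sub_zero]
  · change u.1 i - (α + β * p.1 i + γ * p.1 i ^ 2) = 0
    rw [sub_eq_zero, ← entry_succ u.1, ← entry_succ p.1]
    generalize hk : (i : ℕ) = k at hi
    interval_cases k
    exacts [h1.symm, h2.symm, h3.symm]
  · exact sub_eq_zero.2 (h4 i hi)

/-- A holomorphic function is annihilated by the generators if and only if it is locally a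
holomorphic function of the invariants. -/
theorem isInfinitesimallyInvariantAt_iff_exists (hn : 4 ≤ n)
    {U : Set ((Fin n → ℂ) × (Fin n → ℂ))} (hU : IsOpen U) (hgen : ∀ p ∈ U, GenericElements p)
    {f : (Fin n → ℂ) × (Fin n → ℂ) → ℂ} (hf : DifferentiableOn ℂ f U) :
    (∀ p ∈ U, IsInfinitesimallyInvariantAt f p) ↔
      ∀ p ∈ U, ∃ V : Set ((Fin n → ℂ) × (Fin n → ℂ)), IsOpen V ∧ p ∈ V ∧ V ⊆ U ∧
        ∃ W : Set (InvIndex n → ℂ), IsOpen W ∧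
        ∃ F : (InvIndex n → ℂ) → ℂ, DifferentiableOn ℂ F W ∧
          ∀ q ∈ V, fundInv q ∈ W ∧ f q = F (fundInv q) := by
  constructor
  · intro hinv p hp
    have hpN := (hgen p hp).nondegenerate
    have hR := differentiableAt_reconstruct hn (z := (p, fundInv p))
      (reconstructible_fundInv hn hpN)
    have hUn : U ∈ 𝓝 (reconstruct p (fundInv p)) := by
      rw [reconstruct_fundInv hn hpN]; exact hU.mem_nhds hp
    have hgood : ∀ᶠ z : ((Fin n → ℂ) × (Fin n → ℂ)) × (InvIndex n → ℂ) in 𝓝 (p, fundInv p),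
        Reconstructible z.1 z.2 ∧ reconstruct z.1 z.2 ∈ U :=
      (eventually_reconstructible hn hpN).and (hR.continuousAt.eventually hUn)
    -- A product neighbourhood lets the base tuple and the invariants vary independently; the ball
    -- supplies connectedness in the base.
    rw [nhds_prod_eq, Filter.eventually_prod_iff] at hgood
    obtain ⟨P, hP, Q, hQ, hPQ⟩ := hgood
    obtain ⟨ε, hε, hball⟩ := Metric.eventually_nhds_iff_ball.1 hP
    obtain ⟨W, hW, hWo, hpW⟩ := eventually_nhds_iff.1 hQ
    have hpb : p ∈ Metric.ball p ε := Metric.mem_ball_self hε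
    have hdR : ∀ z ∈ Metric.ball p ε, ∀ y ∈ W, DifferentiableAt ℂ
        (fun x : ((Fin n → ℂ) × (Fin n → ℂ)) × (InvIndex n → ℂ) => reconstruct x.1 x.2) (z, y) :=
      fun z hz y hy => differentiableAt_reconstruct hn (z := (z, y))
        (hPQ (hball z hz) (hW y hy)).1
    have hcont : ContinuousOn (fundInv (n := n) (K := ℂ)) U := fun q hq =>
      (differentiableAt_fundInv hn (hgen q hq).nondegenerate).continuousAt.continuousWithinAt
    refine ⟨(U ∩ fundInv ⁻¹' W) ∩ Metric.ball p ε,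
      (hcont.isOpen_inter_preimage hU hWo).inter Metric.isOpen_ball, ⟨⟨hp, hpW⟩, hpb⟩,
      fun q hq => hq.1.1, W, hWo, fun y => f (reconstruct p y), ?_, ?_⟩
    · intro y hy
      have h1 : DifferentiableAt ℂ f (reconstruct p y) :=
        (hf _ (hPQ (hball p hpb) (hW y hy)).2).differentiableAt
          (hU.mem_nhds (hPQ (hball p hpb) (hW y hy)).2)
      have h2 : DifferentiableAt ℂ (fun y => reconstruct p y) y :=
        DifferentiableAt.comp y (f := fun y => (p, y)) (hdR p hpb y hy)
          ((differentiableAt_const p).prodMk differentiableAt_id)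
      exact (h1.comp y h2).differentiableWithinAt
    · rintro q ⟨⟨hqU, hqW⟩, hqb⟩
      refine ⟨hqW, ?_⟩
      set y := fundInv q with hy
      have hq : f q = f (reconstruct q y) := by
        rw [hy, reconstruct_fundInv hn (hgen q hqU).nondegenerate]
      rw [hq]
      have hd2 : ∀ z ∈ Metric.ball p ε, DifferentiableAt ℂ (fun z => reconstruct z y) z :=
        fun z hz => DifferentiableAt.comp z (f := fun z => (z, y)) (hdR z hz y hqW)
          (differentiableAt_id.prodMk (differentiableAt_const y))
      have hd1 : ∀ z ∈ Metric.ball p ε, DifferentiableAt ℂ f (reconstruct z y) := fun z hz =>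
        (hf _ (hPQ (hball z hz) (hW y hqW)).2).differentiableAt
          (hU.mem_nhds (hPQ (hball z hz) (hW y hqW)).2)
      -- The base moves from `q` to `p` with `y` fixed. The reconstructed tuple stays in the fibre
      -- of `y`, so its velocity is a combination of generators and `f` does not change.
      refine Metric.isOpen_ball.is_const_of_fderiv_eq_zero (𝕜 := ℂ)
        (f := fun z => f (reconstruct z y))
        (convex_ball p ε).isPreconnected
        (fun z hz => ((hd1 z hz).comp z (hd2 z hz)).differentiableWithinAt) ?_ hqb hpb
      intro z hz
      have hzU := (hPQ (hball z hz) (hW y hqW)).2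
      have hzN := (hgen _ hzU)
      refine ContinuousLinearMap.ext fun x => ?_
      have h1 : fderiv ℂ (fun z => f (reconstruct z y)) z
          = (fderiv ℂ f (reconstruct z y)).comp (fderiv ℂ (fun z => reconstruct z y) z) :=
        fderiv_comp z (hd1 z hz) (hd2 z hz)
      have h2 : fderiv ℂ (fun z => fundInv (reconstruct z y)) z
          = (fderiv ℂ fundInv (reconstruct z y)).comp (fderiv ℂ (fun z => reconstruct z y) z) :=
        fderiv_comp z (differentiableAt_fundInv hn hzN.nondegenerate) (hd2 z hz)
      have h3 : (fun z => fundInv (reconstruct z y)) =ᶠ[𝓝 z] fun _ => y := by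
        filter_upwards [Metric.isOpen_ball.mem_nhds hz] with z' hz'
        exact fundInv_reconstruct hn (hPQ (hball z' hz') (hW y hqW)).1
      rw [h3.fderiv_eq, fderiv_fun_const] at h2
      have h4 : fderiv ℂ fundInv (reconstruct z y) (fderiv ℂ (fun z => reconstruct z y) z x) = 0 :=
        (congrArg (fun T => T x) h2).symm
      obtain ⟨α, β, γ, κ, A, B, C, D, hX⟩ := exists_generatorField_eq hn hzN h4
      rw [h1]
      change fderiv ℂ f (reconstruct z y) (fderiv ℂ (fun z => reconstruct z y) z x) = 0
      rw [hX]
      exact (isInfinitesimallyInvariantAt_iff f _).1 (hinv _ hzU) α β γ κ A B C D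
  · intro h p hp
    obtain ⟨V, hV, hpV, -, W, hW, F, hF, hVF⟩ := h p hp
    have hpN := (hgen p hp).nondegenerate
    rw [isInfinitesimallyInvariantAt_iff]
    intro α β γ κ A B C D
    have hFd : DifferentiableAt ℂ F (fundInv p) :=
      (hF _ (hVF p hpV).1).differentiableAt (hW.mem_nhds (hVF p hpV).1)
    have h1 : f =ᶠ[𝓝 p] F ∘ fundInv := by
      filter_upwards [hV.mem_nhds hpV] with q hq using (hVF q hq).2
    rw [h1.fderiv_eq, fderiv_comp p hFd (differentiableAt_fundInv hn hpN),
      ContinuousLinearMap.comp_apply, fderiv_fundInv_generatorField hn hpN, map_zero]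

end Infinitesimal

/-! ### Compatibility of the formulas with field homomorphisms. -/

section Naturality

variable {K L : Type*} [Field K] [Field L] {n : ℕ} (f : K →+* L)

theorem map_entry (x : Fin n → K) (k : ℕ) : f (entry x k) = entry (fun i => f (x i)) k := by
  unfold entry
  split_ifs
  · rfl
  · exact map_zero f

theorem map_diffRatio (x : Fin n → K) (k : ℕ) :
    f (diffRatio x k) = diffRatio (fun i => f (x i)) k := by
  simp only [diffRatio, map_div₀, map_sub, map_entry]

theorem map_r (v : Fin n → K) (k : ℕ) : f (r v k) = r (fun i => f (v i)) k := by
  simp only [r, map_div₀, map_sub, map_mul, map_one, map_diffRatio]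

theorem map_s (v w : Fin n → K) (k : ℕ) :
    f (s v w k) = s (fun i => f (v i)) (fun i => f (w i)) k := by
  simp only [s, map_div₀, map_pow, map_diffRatio]

theorem map_sigma (v w : Fin n → K) (k : ℕ) :
    f (sigma v w k) = sigma (fun i => f (v i)) (fun i => f (w i)) k := by
  simp only [sigma, map_div₀, map_sub, map_one, map_s]

theorem map_omegaNum (v w : Fin n → K) (k : ℕ) :
    f (omegaNum v w k) = omegaNum (fun i => f (v i)) (fun i => f (w i)) k := by
  simp only [omegaNum, tau, map_div₀, map_sub, map_mul, map_pow, map_sigma, map_r]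

theorem map_fundInv (p : (Fin n → K) × (Fin n → K)) (k : InvIndex n) :
    f (fundInv p k) = fundInv (fun i => f (p.1 i), fun i => f (p.2 i)) k := by
  rcases k with j | l
  · exact map_r f _ _
  · simp only [fundInv, Omega, map_div₀, map_omegaNum]

theorem Nondegenerate.map {p : (Fin n → K) × (Fin n → K)} (hp : Nondegenerate p) :
    Nondegenerate ((fun i => f (p.1 i), fun i => f (p.2 i)) : (Fin n → L) × (Fin n → L)) := by
  refine ⟨f.injective.comp hp.1, fun h6 => ?_⟩
  obtain ⟨h1, h2, h3, h4⟩ := hp.2 h6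
  simp only [← map_entry, ← map_s, ← map_sigma, ← map_r, ← map_omegaNum]
  exact ⟨f.injective.ne h1, by simpa using f.injective.ne h2, f.injective.ne h3,
    by simpa using f.injective.ne h4⟩

theorem map_directionOf (a b c ρ : K) :
    f (directionOf a b c ρ) = directionOf (f a) (f b) (f c) (f ρ) := by
  simp only [directionOf, map_div₀, map_sub, map_mul]

theorem map_cubicInterp (v w : Fin n → K) (x : K) :
    f (cubicInterp v w x) = cubicInterp (fun i => f (v i)) (fun i => f (w i)) (f x) := by
  simp only [cubicInterp, lagrangeCubic, map_add, map_div₀, map_sub, map_mul, map_entry]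

theorem map_excess (v w : Fin n → K) (k : ℕ) :
    f (excess v w k) = excess (fun i => f (v i)) (fun i => f (w i)) k := by
  simp only [excess, map_div₀, map_sub, map_pow, map_cubicInterp, map_entry]

theorem map_reconstructV (v : Fin n → K) (y : InvIndex n → K) (i : Fin n) :
    f (reconstructV v y i) = reconstructV (fun i => f (v i)) (fun k => f (y k)) i := by
  unfold reconstructV
  split_ifs
  · simp only [map_directionOf, map_entry]
  · rfl

theorem map_reconstructW (v w : Fin n → K) (y : InvIndex n → K) (i : Fin n) :
    f (reconstructW v w y i)
      = reconstructW (fun i => f (v i)) (fun i => f (w i)) (fun k => f (y k)) i := by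
  unfold reconstructW
  split_ifs
  · simp only [map_add, map_mul, map_pow, map_sub, map_cubicInterp, map_excess, map_entry]
  · rfl

/-- Applied to the inclusion of the field generated by the invariants, this shows that the section
over a complex tuple has coordinates in that field. -/
theorem map_reconstruct (q : (Fin n → K) × (Fin n → K)) (y : InvIndex n → K) :
    ((fun i => f ((reconstruct q y).1 i), fun i => f ((reconstruct q y).2 i)) :
      (Fin n → L) × (Fin n → L))
      = reconstruct (fun i => f (q.1 i), fun i => f (q.2 i)) (fun k => f (y k)) := by
  simp only [reconstruct, map_reconstructV, map_reconstructW]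

end Naturality

/-! ### Rational functions as germs at generic points. -/

section Germs

variable {n : ℕ}

/-- The value of a polynomial at a tuple of elements. -/
noncomputable def evalAt (x : (Fin n → ℂ) × (Fin n → ℂ)) : PolyVW n →ₐ[ℂ] ℂ :=
  MvPolynomial.aeval (Sum.elim x.1 x.2)

theorem analyticOnNhd_evalAt (P : PolyVW n) :
    AnalyticOnNhd ℂ (fun x : (Fin n → ℂ) × (Fin n → ℂ) => evalAt x P) Set.univ := by
  refine AnalyticOnNhd.aeval_mvPolynomial (fun i => ?_) P
  rcases i with i | i
  · exact ((ContinuousLinearMap.proj (R := ℂ) (φ := fun _ : Fin n => ℂ) i).comp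
      (ContinuousLinearMap.fst ℂ (Fin n → ℂ) (Fin n → ℂ))).analyticOnNhd _
  · exact ((ContinuousLinearMap.proj (R := ℂ) (φ := fun _ : Fin n => ℂ) i).comp
      (ContinuousLinearMap.snd ℂ (Fin n → ℂ) (Fin n → ℂ))).analyticOnNhd _

theorem continuous_evalAt (P : PolyVW n) :
    Continuous (fun x : (Fin n → ℂ) × (Fin n → ℂ) => evalAt x P) :=
  continuousOn_univ.1 (analyticOnNhd_evalAt P).continuousOn

theorem eq_zero_of_evalAt {P : PolyVW n} (h : ∀ x, evalAt x P = 0) : P = 0 := by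
  refine MvPolynomial.funext fun x => ?_
  have := h (x ∘ Sum.inl, x ∘ Sum.inr)
  rw [evalAt, Sum.elim_comp_inl_inr] at this
  simpa [MvPolynomial.aeval_eq_eval] using this

/-- The identity theorem: a polynomial vanishing near `x₀` vanishes everywhere. -/
theorem frequently_evalAt_ne_zero {P : PolyVW n} (hP : P ≠ 0) (x₀ : (Fin n → ℂ) × (Fin n → ℂ)) :
    ∃ᶠ x in 𝓝 x₀, evalAt x P ≠ 0 := by
  intro h
  refine hP (eq_zero_of_evalAt fun x => ?_)
  have h' : (fun x : (Fin n → ℂ) × (Fin n → ℂ) => evalAt x P) =ᶠ[𝓝 x₀] 0 := by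
    filter_upwards [h] with x hx using not_not.1 hx
  exact (analyticOnNhd_evalAt P).eqOn_zero_of_preconnected_of_eventuallyEq_zero
    isPreconnected_univ (Set.mem_univ x₀) h' (Set.mem_univ x)

/-- The filter generated by the neighbourhoods of `x₀` and the complements of hypersurfaces. -/
def genericFilter (x₀ : (Fin n → ℂ) × (Fin n → ℂ)) : Filter ((Fin n → ℂ) × (Fin n → ℂ)) where
  sets := {S | ∃ P : PolyVW n, P ≠ 0 ∧ ∀ᶠ x in 𝓝 x₀, evalAt x P ≠ 0 → x ∈ S}
  univ_sets := ⟨1, one_ne_zero, Eventually.of_forall fun _ _ => Set.mem_univ _⟩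
  sets_of_superset := by
    rintro S T ⟨P, hP, h⟩ hST
    exact ⟨P, hP, h.mono fun x hx h' => hST (hx h')⟩
  inter_sets := by
    rintro S T ⟨P, hP, h⟩ ⟨Q, hQ, h'⟩
    refine ⟨P * Q, mul_ne_zero hP hQ, ?_⟩
    filter_upwards [h, h'] with x hx hx' hne
    rw [map_mul] at hne
    exact ⟨hx (left_ne_zero_of_mul hne), hx' (right_ne_zero_of_mul hne)⟩

/-- This permits refinement to an ultrafilter, along which germs form a field, so that quotients of
rational functions become pointwise quotients. -/
instance genericFilter_neBot (x₀ : (Fin n → ℂ) × (Fin n → ℂ)) : (genericFilter x₀).NeBot := by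
  refine ⟨fun h => ?_⟩
  obtain ⟨P, hP, h'⟩ : ∅ ∈ genericFilter x₀ := h ▸ mem_bot
  exact frequently_evalAt_ne_zero hP x₀ h'

/-- An ultrafilter of points near `x₀` outside all hypersurfaces. -/
noncomputable def genericUltrafilter (x₀ : (Fin n → ℂ) × (Fin n → ℂ)) :
    Ultrafilter ((Fin n → ℂ) × (Fin n → ℂ)) := Ultrafilter.of (genericFilter x₀)

theorem genericUltrafilter_le_nhds (x₀ : (Fin n → ℂ) × (Fin n → ℂ)) :
    (genericUltrafilter x₀ : Filter ((Fin n → ℂ) × (Fin n → ℂ))) ≤ 𝓝 x₀ := by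
  refine (Ultrafilter.of_le _).trans fun S hS => ⟨1, one_ne_zero, ?_⟩
  filter_upwards [hS] with x hx _ using hx

theorem eventually_genericUltrafilter {P : PolyVW n} (hP : P ≠ 0)
    (x₀ : (Fin n → ℂ) × (Fin n → ℂ)) :
    ∀ᶠ x in (genericUltrafilter x₀ : Filter ((Fin n → ℂ) × (Fin n → ℂ))), evalAt x P ≠ 0 :=
  Ultrafilter.of_le _ ⟨P, hP, Eventually.of_forall fun _ h => h⟩

/-- The germ of the polynomial function of a polynomial. -/
noncomputable def polyGerm (x₀ : (Fin n → ℂ) × (Fin n → ℂ)) :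
    PolyVW n →+* Germ (genericUltrafilter x₀ : Filter ((Fin n → ℂ) × (Fin n → ℂ))) ℂ :=
  (Germ.coeRingHom (R := ℂ)
    (genericUltrafilter x₀ : Filter ((Fin n → ℂ) × (Fin n → ℂ)))).comp
      (RingHom.pi fun x => (evalAt x).toRingHom)

theorem polyGerm_injective (x₀ : (Fin n → ℂ) × (Fin n → ℂ)) :
    Function.Injective (polyGerm x₀) := by
  refine (injective_iff_map_eq_zero _).2 fun P hP => ?_
  by_contra hne
  have h1 : (fun x => evalAt x P) =ᶠ[(genericUltrafilter x₀ :
      Filter ((Fin n → ℂ) × (Fin n → ℂ)))] fun _ => 0 := Germ.coe_eq.1 hP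
  obtain ⟨x, hx, hx'⟩ := (h1.and (eventually_genericUltrafilter hne x₀)).exists
  exact hx' hx

/-- The germ of a rational function. -/
noncomputable def ratGerm (x₀ : (Fin n → ℂ) × (Fin n → ℂ)) :
    RatVW n →+* Germ (genericUltrafilter x₀ : Filter ((Fin n → ℂ) × (Fin n → ℂ))) ℂ :=
  IsFractionRing.lift (polyGerm_injective x₀)

/-- The function `h` represents the rational function `φ` generically near `x₀`. -/
def Represents (x₀ : (Fin n → ℂ) × (Fin n → ℂ)) (φ : RatVW n)
    (h : (Fin n → ℂ) × (Fin n → ℂ) → ℂ) : Prop :=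
  ratGerm x₀ φ = (h : Germ (genericUltrafilter x₀ : Filter ((Fin n → ℂ) × (Fin n → ℂ))) ℂ)

variable {x₀ : (Fin n → ℂ) × (Fin n → ℂ)} {φ ψ : RatVW n}
  {h k : (Fin n → ℂ) × (Fin n → ℂ) → ℂ}

/-- `ratGerm` is injective, being a homomorphism of fields. This transfers identities between the
function field and points near `x₀`. -/
theorem Represents.eq_iff (hφ : Represents x₀ φ h) (hψ : Represents x₀ ψ k) :
    φ = ψ ↔ ∀ᶠ x in (genericUltrafilter x₀ : Filter ((Fin n → ℂ) × (Fin n → ℂ))), h x = k x := by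
  rw [← (ratGerm x₀).injective.eq_iff, hφ, hψ]
  exact Germ.coe_eq

theorem Represents.add (hφ : Represents x₀ φ h) (hψ : Represents x₀ ψ k) :
    Represents x₀ (φ + ψ) (fun x => h x + k x) := by
  rw [Represents, map_add, hφ, hψ]; rfl

theorem Represents.sub (hφ : Represents x₀ φ h) (hψ : Represents x₀ ψ k) :
    Represents x₀ (φ - ψ) (fun x => h x - k x) := by
  rw [Represents, map_sub, hφ, hψ]; rfl

theorem Represents.mul (hφ : Represents x₀ φ h) (hψ : Represents x₀ ψ k) :
    Represents x₀ (φ * ψ) (fun x => h x * k x) := by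
  rw [Represents, map_mul, hφ, hψ]; rfl

theorem Represents.div (hφ : Represents x₀ φ h) (hψ : Represents x₀ ψ k) :
    Represents x₀ (φ / ψ) (fun x => h x / k x) := by
  rw [Represents, map_div₀, hφ, hψ]; rfl

theorem Represents.pow (hφ : Represents x₀ φ h) (m : ℕ) :
    Represents x₀ (φ ^ m) (fun x => h x ^ m) := by
  rw [Represents, map_pow, hφ]; rfl

theorem represents_poly (x₀ : (Fin n → ℂ) × (Fin n → ℂ)) (P : PolyVW n) :
    Represents x₀ (algebraMap (PolyVW n) (RatVW n) P) (fun x => evalAt x P) := by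
  rw [Represents, ratGerm, IsFractionRing.lift_algebraMap]; rfl

theorem represents_const (x₀ : (Fin n → ℂ) × (Fin n → ℂ)) (c : ℂ) :
    Represents x₀ (algebraMap ℂ (RatVW n) c) (fun _ => c) := by
  have h := represents_poly x₀ (MvPolynomial.C c)
  have e : (fun x : (Fin n → ℂ) × (Fin n → ℂ) => evalAt x (MvPolynomial.C c)) = fun _ => c := by
    ext x; simp [evalAt]
  rw [e] at h
  rwa [IsScalarTower.algebraMap_apply ℂ (PolyVW n) (RatVW n), MvPolynomial.algebraMap_eq]

theorem represents_zero (x₀ : (Fin n → ℂ) × (Fin n → ℂ)) :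
    Represents x₀ (0 : RatVW n) (fun _ => 0) := by
  simpa using represents_const x₀ 0

theorem represents_one (x₀ : (Fin n → ℂ) × (Fin n → ℂ)) :
    Represents x₀ (1 : RatVW n) (fun _ => 1) := by
  simpa using represents_const x₀ 1

theorem represents_genericPoint_fst (x₀ : (Fin n → ℂ) × (Fin n → ℂ)) (i : Fin n) :
    Represents x₀ ((genericPoint n).1 i) (fun x => x.1 i) := by
  have h := represents_poly x₀ (MvPolynomial.X (Sum.inl i))
  have e : (fun x : (Fin n → ℂ) × (Fin n → ℂ) => evalAt x (MvPolynomial.X (Sum.inl i)))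
      = fun x => x.1 i := by
    ext x; simp [evalAt]
  rw [e] at h
  exact h

theorem represents_genericPoint_snd (x₀ : (Fin n → ℂ) × (Fin n → ℂ)) (i : Fin n) :
    Represents x₀ ((genericPoint n).2 i) (fun x => x.2 i) := by
  have h := represents_poly x₀ (MvPolynomial.X (Sum.inr i))
  have e : (fun x : (Fin n → ℂ) × (Fin n → ℂ) => evalAt x (MvPolynomial.X (Sum.inr i)))
      = fun x => x.2 i := by
    ext x; simp [evalAt]
  rw [e] at h
  exact h

variable {v w : Fin n → RatVW n} {v' w' : (Fin n → ℂ) × (Fin n → ℂ) → Fin n → ℂ}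

theorem represents_entry (hv : ∀ i, Represents x₀ (v i) (fun x => v' x i)) (k : ℕ) :
    Represents x₀ (entry v k) (fun x => entry (v' x) k) := by
  unfold entry
  split_ifs
  · exact hv _
  · exact represents_zero x₀

theorem represents_diffRatio (hv : ∀ i, Represents x₀ (v i) (fun x => v' x i)) (k : ℕ) :
    Represents x₀ (diffRatio v k) (fun x => diffRatio (v' x) k) :=
  ((represents_entry hv k).sub (represents_entry hv 1)).div
    ((represents_entry hv 2).sub (represents_entry hv 1))

theorem represents_r (hv : ∀ i, Represents x₀ (v i) (fun x => v' x i)) (k : ℕ) :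
    Represents x₀ (r v k) (fun x => r (v' x) k) :=
  have e := fun k => represents_diffRatio hv k
  have o := represents_one x₀
  ((e 3).mul ((e k).sub o)).div ((e k).mul ((e 3).sub o))

theorem represents_s (hv : ∀ i, Represents x₀ (v i) (fun x => v' x i))
    (hw : ∀ i, Represents x₀ (w i) (fun x => w' x i)) (k : ℕ) :
    Represents x₀ (s v w k) (fun x => s (v' x) (w' x) k) :=
  (represents_diffRatio hw k).div ((represents_diffRatio hv k).pow 3)

theorem represents_sigma (hv : ∀ i, Represents x₀ (v i) (fun x => v' x i))
    (hw : ∀ i, Represents x₀ (w i) (fun x => w' x i)) (k : ℕ) :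
    Represents x₀ (sigma v w k) (fun x => sigma (v' x) (w' x) k) :=
  have o := represents_one x₀
  ((represents_s hv hw k).sub o).div ((represents_s hv hw 3).sub o)

theorem represents_omegaNum (hv : ∀ i, Represents x₀ (v i) (fun x => v' x i))
    (hw : ∀ i, Represents x₀ (w i) (fun x => w' x i)) (k : ℕ) :
    Represents x₀ (omegaNum v w k) (fun x => omegaNum (v' x) (w' x) k) :=
  have e := fun k => represents_r hv k
  have e' := fun k => represents_sigma hv hw k
  ((((e 4).pow 2).sub (e 4)).mul (((e' k).sub (e k)).div ((e' 4).sub (e 4)))).sub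
    (((e k).pow 2).sub (e k))

theorem represents_fundInv (hv : ∀ i, Represents x₀ (v i) (fun x => v' x i))
    (hw : ∀ i, Represents x₀ (w i) (fun x => w' x i)) (k : InvIndex n) :
    Represents x₀ (fundInv (v, w) k) (fun x => fundInv (v' x, w' x) k) := by
  rcases k with j | l
  · exact represents_r hv _
  · exact (represents_omegaNum hv hw _).div (represents_omegaNum hv hw _)

theorem represents_cubicInterp (hv : ∀ i, Represents x₀ (v i) (fun x => v' x i))
    (hw : ∀ i, Represents x₀ (w i) (fun x => w' x i)) (hφ : Represents x₀ φ h) :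
    Represents x₀ (cubicInterp v w φ) (fun x => cubicInterp (v' x) (w' x) (h x)) := by
  have e := fun k => represents_entry hv k
  have e' := fun k => represents_entry hw k
  have hterm : ∀ i a b c : ℕ, Represents x₀ (entry w i /
      ((entry v i - entry v a) * (entry v i - entry v b) * (entry v i - entry v c)) *
      ((φ - entry v a) * (φ - entry v b) * (φ - entry v c)))
      (fun x => entry (w' x) i / ((entry (v' x) i - entry (v' x) a) *
        (entry (v' x) i - entry (v' x) b) * (entry (v' x) i - entry (v' x) c)) *
        ((h x - entry (v' x) a) * (h x - entry (v' x) b) * (h x - entry (v' x) c))) :=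
    fun i a b c => ((e' i).div ((((e i).sub (e a)).mul ((e i).sub (e b))).mul
      ((e i).sub (e c)))).mul (((hφ.sub (e a)).mul (hφ.sub (e b))).mul (hφ.sub (e c)))
  exact (((hterm 1 2 3 4).add (hterm 2 1 3 4)).add (hterm 3 1 2 4)).add (hterm 4 1 2 3)

theorem represents_reconstructV {y : InvIndex n → RatVW n}
    {y' : (Fin n → ℂ) × (Fin n → ℂ) → InvIndex n → ℂ}
    (hv : ∀ i, Represents x₀ (v i) (fun x => v' x i))
    (hy : ∀ k, Represents x₀ (y k) (fun x => y' x k)) (i : Fin n) :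
    Represents x₀ (reconstructV v y i) (fun x => reconstructV (v' x) (y' x) i) := by
  have e := fun k => represents_entry hv k
  unfold reconstructV
  split_ifs
  · exact ((((hy _).mul ((e 3).sub (e 2))).mul (e 1)).sub (((e 3).sub (e 1)).mul (e 2))).div
        (((hy _).mul ((e 3).sub (e 2))).sub ((e 3).sub (e 1)))
  · exact hv i

theorem represents_reconstructW {y : InvIndex n → RatVW n}
    {y' : (Fin n → ℂ) × (Fin n → ℂ) → InvIndex n → ℂ}
    (hv : ∀ i, Represents x₀ (v i) (fun x => v' x i))
    (hw : ∀ i, Represents x₀ (w i) (fun x => w' x i))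
    (hy : ∀ k, Represents x₀ (y k) (fun x => y' x k)) (i : Fin n) :
    Represents x₀ (reconstructW v w y i) (fun x => reconstructW (v' x) (w' x) (y' x) i) := by
  unfold reconstructW
  split_ifs
  · exact (represents_cubicInterp hv hw (hv i)).add (((hy _).mul
      (((represents_entry hw 5).sub (represents_cubicInterp hv hw (represents_entry hv 5))).div
        (((represents_entry hv 5).sub (represents_entry hv 1)).pow 3))).mul
        (((hv i).sub (represents_entry hv 1)).pow 3))
  · exact hw i

theorem represents_aeval {y : Fin n ⊕ Fin n → RatVW n}
    {y' : (Fin n → ℂ) × (Fin n → ℂ) → Fin n ⊕ Fin n → ℂ}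
    (hy : ∀ k, Represents x₀ (y k) (fun x => y' x k)) (P : PolyVW n) :
    Represents x₀ (MvPolynomial.aeval y P) (fun x => MvPolynomial.aeval (y' x) P) := by
  induction P using MvPolynomial.induction_on with
  | C a => simpa using represents_const x₀ a
  | add p q hp hq => simpa using hp.add hq
  | mul_X p i hp => simpa using hp.mul (hy i)

theorem represents_den (g : PointParam) (hφ : Represents x₀ φ h) :
    Represents x₀ (g.den φ) (fun x => g.den (h x)) :=
  ((represents_const x₀ g.c).mul hφ).add (represents_const x₀ g.d)

theorem represents_subst (g : PointParam) (P : PolyVW n) :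
    Represents x₀ (g.subst P) (fun x => evalAt (g.act x) P) := by
  have c := represents_const x₀
  have hv := represents_genericPoint_fst x₀
  have hw := represents_genericPoint_snd x₀
  refine represents_aeval (y' := fun x => Sum.elim (g.act x).1 (g.act x).2) ?_ P
  rintro (i | i)
  · exact (((c g.a).mul (hv i)).add (c g.b)).div (represents_den g (hv i))
  · exact (((((c g.lam).add ((c g.mu).mul (hv i))).add ((c g.nu).mul ((hv i).pow 2))).add
      ((c g.xi).mul ((hv i).pow 3))).add ((c (g.a * g.d - g.b * g.c)).mul (hw i))).div
      ((represents_den g (hv i)).pow 3)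

end Germs

/-! ### Rational invariants. -/

section Rational

variable {n : ℕ}

theorem continuousAt_act (g : PointParam) {x₀ : (Fin n → ℂ) × (Fin n → ℂ)} (h : g.DefinedAt x₀) :
    ContinuousAt (fun x : (Fin n → ℂ) × (Fin n → ℂ) => g.act x) x₀ := by
  have h1 : ∀ i, ContinuousAt (fun x : (Fin n → ℂ) × (Fin n → ℂ) => g.den (x.1 i)) x₀ := by
    intro i
    unfold PointParam.den
    fun_prop
  refine ContinuousAt.prodMk (continuousAt_pi.2 fun i => ?_) (continuousAt_pi.2 fun i => ?_)
  · exact ContinuousAt.div₀ (by fun_prop) (h1 i) (h i)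
  · exact ContinuousAt.div₀ (by fun_prop) ((h1 i).pow 3) (pow_ne_zero _ (h i))

theorem exists_linear_ne_zero {c d : ℂ} (h : c ≠ 0 ∨ d ≠ 0) : ∃ z : ℂ, c * z + d ≠ 0 := by
  by_cases hd : d = 0
  · exact ⟨1, by simpa [hd] using h⟩
  · exact ⟨0, by simpa using hd⟩

theorem exists_definedAt (g : PointParam) : ∃ x : (Fin n → ℂ) × (Fin n → ℂ), g.DefinedAt x := by
  obtain ⟨z, hz⟩ := exists_linear_ne_zero (c := g.c) (d := g.d) (by
    by_contra! h
    exact g.det_ne_zero (by rw [h.1, h.2]; ring))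
  exact ⟨(fun _ => z, 0), fun _ => hz⟩

/-- The inverse transformation. -/
theorem exists_act_eq_of_ne_zero (g : PointParam) {y : (Fin n → ℂ) × (Fin n → ℂ)}
    (hy : ∀ i, -g.c * y.1 i + g.a ≠ 0) : ∃ x, g.DefinedAt x ∧ g.act x = y := by
  have hΔ := g.det_ne_zero
  have hden : ∀ i, g.den ((g.d * y.1 i - g.b) / (-g.c * y.1 i + g.a))
      = (g.a * g.d - g.b * g.c) / (-g.c * y.1 i + g.a) := fun i => by
    change g.c * ((g.d * y.1 i - g.b) / (-g.c * y.1 i + g.a)) + g.d = _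
    rw [eq_div_iff (hy i), add_mul, mul_assoc, div_mul_cancel₀ _ (hy i)]
    ring
  refine ⟨(fun i => (g.d * y.1 i - g.b) / (-g.c * y.1 i + g.a), fun i =>
    (y.2 i * g.den ((g.d * y.1 i - g.b) / (-g.c * y.1 i + g.a)) ^ 3
      - (g.lam + g.mu * ((g.d * y.1 i - g.b) / (-g.c * y.1 i + g.a))
        + g.nu * ((g.d * y.1 i - g.b) / (-g.c * y.1 i + g.a)) ^ 2
        + g.xi * ((g.d * y.1 i - g.b) / (-g.c * y.1 i + g.a)) ^ 3))
        / (g.a * g.d - g.b * g.c)), fun i => ?_, Prod.ext (funext fun i => ?_)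
          (funext fun i => ?_)⟩
  · change g.den ((g.d * y.1 i - g.b) / (-g.c * y.1 i + g.a)) ≠ 0
    rw [hden]
    exact div_ne_zero hΔ (hy i)
  · change (g.a * ((g.d * y.1 i - g.b) / (-g.c * y.1 i + g.a)) + g.b)
      / g.den ((g.d * y.1 i - g.b) / (-g.c * y.1 i + g.a)) = y.1 i
    rw [hden, div_eq_iff (div_ne_zero hΔ (hy i)), ← mul_div_assoc, ← mul_div_assoc,
      div_add' _ _ _ (hy i), div_left_inj' (hy i)]
    ring
  · have h3 : g.den ((g.d * y.1 i - g.b) / (-g.c * y.1 i + g.a)) ^ 3 ≠ 0 := by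
      rw [hden]
      exact pow_ne_zero _ (div_ne_zero hΔ (hy i))
    generalize hz : (g.d * y.1 i - g.b) / (-g.c * y.1 i + g.a) = z at h3
    change (g.lam + g.mu * ((g.d * y.1 i - g.b) / (-g.c * y.1 i + g.a))
      + g.nu * ((g.d * y.1 i - g.b) / (-g.c * y.1 i + g.a)) ^ 2
      + g.xi * ((g.d * y.1 i - g.b) / (-g.c * y.1 i + g.a)) ^ 3
      + (g.a * g.d - g.b * g.c) * ((y.2 i * g.den ((g.d * y.1 i - g.b) / (-g.c * y.1 i + g.a)) ^ 3
      - (g.lam + g.mu * ((g.d * y.1 i - g.b) / (-g.c * y.1 i + g.a))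
        + g.nu * ((g.d * y.1 i - g.b) / (-g.c * y.1 i + g.a)) ^ 2
        + g.xi * ((g.d * y.1 i - g.b) / (-g.c * y.1 i + g.a)) ^ 3))
        / (g.a * g.d - g.b * g.c))) / g.den ((g.d * y.1 i - g.b) / (-g.c * y.1 i + g.a)) ^ 3 = y.2 i
    rw [hz, div_eq_iff h3, mul_div_cancel₀ _ hΔ]
    ring

/-- If the substitution kills `P`, then by continuity `P` vanishes at every image point of `g`.
These points contain a nonempty open set, hence $P=0$. -/
theorem subst_injective (g : PointParam) : Function.Injective (g.subst (n := n)) := by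
  refine (injective_iff_map_eq_zero _).2 fun P hP => ?_
  by_contra hne
  have hzero : ∀ x : (Fin n → ℂ) × (Fin n → ℂ), g.DefinedAt x → evalAt (g.act x) P = 0 := by
    intro x hx
    have h1 := ((represents_subst (x₀ := x) g P).eq_iff (represents_zero x)).1 hP
    have h2 : Tendsto (fun x => evalAt (g.act x) P)
        (genericUltrafilter x : Filter ((Fin n → ℂ) × (Fin n → ℂ))) (𝓝 (evalAt (g.act x) P)) :=
      (((continuous_evalAt P).continuousAt.comp (continuousAt_act g hx)).tendsto).mono_left
        (genericUltrafilter_le_nhds x)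
    exact tendsto_nhds_unique (h2.congr' h1) tendsto_const_nhds
  obtain ⟨z, hz⟩ := exists_linear_ne_zero (c := -g.c) (d := g.a) (by
    by_contra! h
    exact g.det_ne_zero (by rw [h.2, neg_eq_zero.1 h.1]; ring))
  have hev : ∀ᶠ y : (Fin n → ℂ) × (Fin n → ℂ) in 𝓝 (fun _ => z, 0),
      ∀ i, -g.c * y.1 i + g.a ≠ 0 := by
    refine eventually_all.2 fun i => ContinuousAt.eventually_ne ?_ hz
    fun_prop
  obtain ⟨y, hy, hy'⟩ := ((frequently_evalAt_ne_zero hne _).and_eventually hev).exists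
  obtain ⟨x, hx, rfl⟩ := exists_act_eq_of_ne_zero g hy'
  exact hy (hzero x hx)

/-- The substitution of the transformed elements in a rational function. -/
noncomputable def PointParam.substRat (g : PointParam) : RatVW n →ₐ[ℂ] RatVW n :=
  IsFractionRing.liftAlgHom (subst_injective g)

theorem substRat_algebraMap (g : PointParam) (P : PolyVW n) :
    g.substRat (algebraMap (PolyVW n) (RatVW n) P) = g.subst P :=
  IsFractionRing.lift_algebraMap (K := RatVW n) (g := (g.subst (n := n)).toRingHom)
    (subst_injective g) P

/-- With substitution extended to the fraction field, invariance no longer refers to a presentation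
$N/Q$. -/
theorem isRationalInvariant_iff (φ : RatVW n) :
    IsRationalInvariant φ ↔ ∀ g : PointParam, g.substRat φ = φ := by
  constructor
  · intro h g
    obtain ⟨N, Q, hQ, rfl⟩ := IsFractionRing.div_surjective (A := PolyVW n) φ
    have hQ0 : Q ≠ 0 := nonZeroDivisors.ne_zero hQ
    have hQ' : algebraMap (PolyVW n) (RatVW n) Q ≠ 0 := by simpa using hQ0
    have hs : g.subst Q ≠ 0 := fun h0 => hQ0 (subst_injective g (by rw [h0, map_zero]))
    have h1 := h g N Q (div_mul_cancel₀ _ hQ')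
    rw [map_div₀, substRat_algebraMap, substRat_algebraMap, div_eq_iff hs, h1]
  · intro h g N Q hNQ
    have := congrArg g.substRat hNQ
    rwa [map_mul, h g, substRat_algebraMap, substRat_algebraMap] at this

/-- Cross-multiplied, invariance is an identity of functions continuous at `x`, so it passes from
generic points to the limit `x` even where `Q` vanishes. -/
theorem IsRationalInvariant.evalAt_act {N Q : PolyVW n} {φ : RatVW n} (hφ : IsRationalInvariant φ)
    (h : φ * algebraMap (PolyVW n) (RatVW n) Q = algebraMap (PolyVW n) (RatVW n) N)
    (g : PointParam) {x : (Fin n → ℂ) × (Fin n → ℂ)} (hx : g.DefinedAt x) :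
    evalAt x N * evalAt (g.act x) Q = evalAt (g.act x) N * evalAt x Q := by
  have h1 : algebraMap (PolyVW n) (RatVW n) N * g.subst Q
      = g.subst N * algebraMap (PolyVW n) (RatVW n) Q := by
    rw [← hφ g N Q h, ← h]; ring
  have h2 := (((represents_poly x N).mul (represents_subst g Q)).eq_iff
    ((represents_subst g N).mul (represents_poly x Q))).1 h1
  have c : ∀ P : PolyVW n, Tendsto (fun x => evalAt x P)
      (genericUltrafilter x : Filter ((Fin n → ℂ) × (Fin n → ℂ))) (𝓝 (evalAt x P)) := fun P =>
    ((continuous_evalAt P).tendsto x).mono_left (genericUltrafilter_le_nhds x)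
  have c' : ∀ P : PolyVW n, Tendsto (fun x => evalAt (g.act x) P)
      (genericUltrafilter x : Filter ((Fin n → ℂ) × (Fin n → ℂ))) (𝓝 (evalAt (g.act x) P)) :=
    fun P => (((continuous_evalAt P).continuousAt.comp (continuousAt_act g hx)).tendsto).mono_left
      (genericUltrafilter_le_nhds x)
  exact tendsto_nhds_unique (((c N).mul (c' Q)).congr' h2) ((c' N).mul (c Q))

theorem exists_genericElements (n : ℕ) : ∃ p : (Fin n → ℂ) × (Fin n → ℂ), GenericElements p := by
  have hv : ∀ k, 1 ≤ k → k ≤ n → entry (fun i : Fin n => ((i : ℕ) : ℂ)) k = (k : ℂ) - 1 := by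
    intro k h1 h2
    rw [entry_of_le _ h1 h2]
    push_cast [Nat.cast_sub h1]
    ring
  have hw : ∀ k, 1 ≤ k → k ≤ n →
      entry (fun i : Fin n => ((i : ℕ) : ℂ) ^ 4) k = ((k : ℂ) - 1) ^ 4 := by
    intro k h1 h2
    rw [entry_of_le _ h1 h2]
    push_cast [Nat.cast_sub h1]
    ring
  -- Integer points on $w=v^4$: the fourth difference is $24$, while that of a cubic is $0$.
  refine ⟨(fun i => ((i : ℕ) : ℂ), fun i => ((i : ℕ) : ℂ) ^ 4), fun i j h => ?_, fun h5 => ?_,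
    fun h6 => ?_⟩
  · exact Fin.ext (Nat.cast_injective (R := ℂ) h)
  · rintro ⟨A, B, C, D, h⟩
    have e := fun k h1 (hk : k ≤ 5) => h k h1 hk
    have e1 := e 1 (by omega) (by omega)
    have e2 := e 2 (by omega) (by omega)
    have e3 := e 3 (by omega) (by omega)
    have e4 := e 4 (by omega) (by omega)
    have e5 := e 5 (by omega) (by omega)
    rw [hv _ (by omega) (by omega), hw _ (by omega) (by omega)] at e1 e2 e3 e4 e5
    norm_num at e1 e2 e3 e4 e5
    have : (24 : ℂ) = 0 := by linear_combination e5 - 4 * e4 + 6 * e3 - 4 * e2 + e1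
    norm_num at this
  · have v1 := hv 1 (by omega) (by omega)
    have v2 := hv 2 (by omega) (by omega)
    have v3 := hv 3 (by omega) (by omega)
    have v4 := hv 4 (by omega) (by omega)
    have v5 := hv 5 (by omega) (by omega)
    have w1 := hw 1 (by omega) (by omega)
    have w2 := hw 2 (by omega) (by omega)
    have w3 := hw 3 (by omega) (by omega)
    have w4 := hw 4 (by omega) (by omega)
    have w5 := hw 5 (by omega) (by omega)
    simp only [omegaNum, tau, sigma, s, r, diffRatio, v1, v2, v3, v4, v5, w1, w2, w3, w4, w5]
    norm_num

/-- A degeneracy of the indeterminates would be inherited by points near a concrete generic tuple,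
where nondegeneracy is an open condition. -/
theorem nondegenerate_genericPoint (hn : 4 ≤ n) : Nondegenerate (genericPoint n) := by
  obtain ⟨p, hp⟩ := exists_genericElements n
  have hN : ∀ᶠ x in (genericUltrafilter p : Filter ((Fin n → ℂ) × (Fin n → ℂ))), Nondegenerate x :=
    genericUltrafilter_le_nhds p (eventually_nondegenerate hn hp.nondegenerate)
  have hv := represents_genericPoint_fst p
  have hw := represents_genericPoint_snd p
  refine ⟨fun i j h => ?_, fun h6 => ⟨fun h => ?_, fun h => ?_, fun h => ?_, fun h => ?_⟩⟩
  · obtain ⟨x, hx, hx'⟩ := ((((hv i).eq_iff (hv j)).1 h).and hN).exists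
    exact hx'.1 hx
  · obtain ⟨x, hx, hx'⟩ := ((((represents_entry hw 2).eq_iff (represents_entry hw 1)).1 h).and
      hN).exists
    exact (hx'.2 h6).1 hx
  · obtain ⟨x, hx, hx'⟩ := ((((represents_s hv hw 3).eq_iff (represents_one p)).1 h).and hN).exists
    exact (hx'.2 h6).2.1 hx
  · obtain ⟨x, hx, hx'⟩ := ((((represents_sigma hv hw 4).eq_iff (represents_r hv 4)).1 h).and
      hN).exists
    exact (hx'.2 h6).2.2.1 hx
  · obtain ⟨x, hx, hx'⟩ := ((((represents_omegaNum hv hw 5).eq_iff (represents_zero p)).1 h).and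
      hN).exists
    exact (hx'.2 h6).2.2.2 hx

theorem definedAt_genericPoint (g : PointParam) : g.DefinedAt (genericPoint n) := by
  intro i h
  obtain ⟨x₀, hx₀⟩ := exists_definedAt (n := n) g
  have h1 := ((represents_den g (represents_genericPoint_fst x₀ i)).eq_iff
    (represents_zero x₀)).1 h
  have h2 : ∀ᶠ x in (genericUltrafilter x₀ : Filter ((Fin n → ℂ) × (Fin n → ℂ))),
      g.den (x.1 i) ≠ 0 := by
    refine genericUltrafilter_le_nhds x₀ (ContinuousAt.eventually_ne ?_ (hx₀ i))
    unfold PointParam.den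
    fun_prop
  obtain ⟨x, hx, hx'⟩ := (h1.and h2).exists
  exact hx' hx

theorem substRat_genericPoint (g : PointParam) :
    ((fun i => g.substRat ((genericPoint n).1 i), fun i => g.substRat ((genericPoint n).2 i)) :
      (Fin n → RatVW n) × (Fin n → RatVW n)) = g.act (genericPoint n) := by
  refine Prod.ext (funext fun i => ?_) (funext fun i => ?_)
  · refine (substRat_algebraMap g _).trans ?_
    simp [PointParam.subst]
  · refine (substRat_algebraMap g _).trans ?_
    simp [PointParam.subst]

/-- Substitution is a field homomorphism moving the generic point by `g`, so naturality reduces this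
to `fundInv_act` over the function field. -/
theorem substRat_fundInv (hn : 4 ≤ n) (g : PointParam) (k : InvIndex n) :
    g.substRat (fundInv (genericPoint n) k) = fundInv (genericPoint n) k := by
  have hN := nondegenerate_genericPoint hn
  have h1 := map_fundInv (g.substRat (n := n) : RatVW n →+* RatVW n) (genericPoint n) k
  have h2 := hN.map (g.substRat (n := n) : RatVW n →+* RatVW n)
  have h3 := substRat_genericPoint (n := n) g
  refine h1.trans ?_
  have h4 : Nondegenerate (g.act (genericPoint n)) := h3 ▸ h2
  exact (congrArg (fun p => fundInv p k) h3).trans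
    (congrFun (fundInv_act hn (definedAt_genericPoint g) hN h4) k)

theorem isRationalInvariant_of_mem_adjoin (hn : 4 ≤ n) {φ : RatVW n}
    (hφ : φ ∈ IntermediateField.adjoin ℂ (Set.range (fundInv (genericPoint n)))) :
    IsRationalInvariant φ := by
  rw [isRationalInvariant_iff]
  intro g
  induction hφ using IntermediateField.adjoin_induction with
  | mem x hx =>
    obtain ⟨k, rfl⟩ := hx
    exact substRat_fundInv hn g k
  | algebraMap x => exact g.substRat.commutes x
  | add x y _ _ hx hy => rw [map_add, hx, hy]
  | inv x _ hx => rw [map_inv₀, hx]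
  | mul x y _ _ hx hy => rw [map_mul, hx, hy]

theorem mem_adjoin_of_isRationalInvariant (hn : 4 ≤ n) {φ : RatVW n}
    (hφ : IsRationalInvariant φ) :
    φ ∈ IntermediateField.adjoin ℂ (Set.range (fundInv (genericPoint n))) := by
  set S := IntermediateField.adjoin ℂ (Set.range (fundInv (genericPoint n))) with hS
  obtain ⟨N, Q, hQ, hNQ⟩ := IsFractionRing.div_surjective (A := PolyVW n) φ
  have hQ0 : Q ≠ 0 := nonZeroDivisors.ne_zero hQ
  have hQ' : algebraMap (PolyVW n) (RatVW n) Q ≠ 0 := by simpa using hQ0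
  have hφQ : φ * algebraMap (PolyVW n) (RatVW n) Q = algebraMap (PolyVW n) (RatVW n) N := by
    rw [← hNQ, div_mul_cancel₀ _ hQ']
  obtain ⟨p, hp⟩ := exists_genericElements n
  obtain ⟨x₁, hx₁Q, hx₁⟩ := ((frequently_evalAt_ne_zero hQ0 p).and_eventually
    (eventually_genericElements hn hp)).exists
  have hN₁ := hx₁.nondegenerate
  let q : (Fin n → S) × (Fin n → S) :=
    (fun i => algebraMap ℂ S (x₁.1 i), fun i => algebraMap ℂ S (x₁.2 i))
  let y : InvIndex n → S := fun k =>
    ⟨fundInv (genericPoint n) k, IntermediateField.subset_adjoin _ _ ⟨k, rfl⟩⟩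
  -- The section over the constant tuple `x₁`, evaluated at the generic invariants: a point with
  -- coordinates in `S`.
  let T : Fin n ⊕ Fin n → S := Sum.elim (reconstruct q y).1 (reconstruct q y).2
  have hT : ∀ k, Represents x₁ (S.val (T k)) (fun x =>
      Sum.elim (reconstruct x₁ (fundInv x)).1 (reconstruct x₁ (fundInv x)).2 k) := by
    have hI : ∀ k, Represents x₁ (fundInv (genericPoint n) k) (fun x => fundInv x k) :=
      represents_fundInv (represents_genericPoint_fst x₁) (represents_genericPoint_snd x₁)
    have hv : ∀ i, Represents x₁ (algebraMap ℂ (RatVW n) (x₁.1 i)) (fun _ => x₁.1 i) :=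
      fun i => represents_const x₁ _
    have hw : ∀ i, Represents x₁ (algebraMap ℂ (RatVW n) (x₁.2 i)) (fun _ => x₁.2 i) :=
      fun i => represents_const x₁ _
    have hV := represents_reconstructV (v' := fun _ => x₁.1) hv hI
    have hmap := map_reconstruct (S.val : S →+* RatVW n) q y
    rintro (i | i)
    · have : S.val (T (Sum.inl i)) = _ := congrFun (congrArg Prod.fst hmap) i
      rw [this]
      exact hV i
    · have : S.val (T (Sum.inr i)) = _ := congrFun (congrArg Prod.snd hmap) i
      rw [this]
      exact represents_reconstructW (w' := fun _ => x₁.2) hV hw hI i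
  have hval : ∀ P : PolyVW n, Represents x₁ (S.val (MvPolynomial.aeval T P))
      (fun x => evalAt (reconstruct x₁ (fundInv x)) P) := by
    intro P
    have := represents_aeval hT P
    have e : MvPolynomial.aeval (fun k => S.val (T k)) P = S.val (MvPolynomial.aeval T P) :=
      (MvPolynomial.comp_aeval_apply T S.val P).symm
    rw [e] at this
    exact this
  have hcont : ContinuousAt (fun x => reconstruct x₁ (fundInv x)) x₁ :=
    ContinuousAt.comp (f := fun x => (x₁, fundInv x))
      (differentiableAt_reconstruct hn (z := (x₁, fundInv x₁))
        (reconstructible_fundInv hn hN₁)).continuousAt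
      (continuousAt_const.prodMk (differentiableAt_fundInv hn hN₁).continuousAt)
  have hcont' : ContinuousAt (fun x => (x₁, fundInv x)) x₁ :=
    continuousAt_const.prodMk (differentiableAt_fundInv hn hN₁).continuousAt
  have e0 : reconstruct x₁ (fundInv x₁) = x₁ := reconstruct_fundInv hn hN₁
  have ev1 : ∀ᶠ x in 𝓝 x₁, evalAt (reconstruct x₁ (fundInv x)) Q ≠ 0 :=
    (ContinuousAt.comp (f := fun x => reconstruct x₁ (fundInv x))
      (continuous_evalAt Q).continuousAt hcont).eventually_ne (by
        change evalAt (reconstruct x₁ (fundInv x₁)) Q ≠ 0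
        rwa [e0])
  have ev2 : ∀ᶠ x in 𝓝 x₁, GenericElements (reconstruct x₁ (fundInv x)) :=
    hcont.eventually (by beta_reduce; rw [e0]; exact eventually_genericElements hn hx₁)
  have ev3 : ∀ᶠ x in 𝓝 x₁, Reconstructible x₁ (fundInv x) :=
    hcont'.eventually (eventually_reconstructible hn hN₁)
  -- Near `x₁`, the tuple `x` and its counterpart on the section have equal invariants, so they lie
  -- in one orbit and `φ` agrees on them. Thus $\varphi=N(T)/Q(T)$.
  have key : ∀ᶠ x in 𝓝 x₁, evalAt x N * evalAt (reconstruct x₁ (fundInv x)) Q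
      = evalAt (reconstruct x₁ (fundInv x)) N * evalAt x Q := by
    filter_upwards [ev2, ev3, eventually_genericElements hn hx₁] with x h2 h3 h4
    obtain ⟨g, hg, hgx⟩ := exists_act_eq_of_fundInv_eq hn h4 h2 (fundInv_reconstruct hn h3).symm
    rw [← hgx]
    exact hφ.evalAt_act hφQ g hg
  have hle := genericUltrafilter_le_nhds x₁
  have h1 : algebraMap (PolyVW n) (RatVW n) N * S.val (MvPolynomial.aeval T Q)
      = S.val (MvPolynomial.aeval T N) * algebraMap (PolyVW n) (RatVW n) Q :=
    (((represents_poly x₁ N).mul (hval Q)).eq_iff ((hval N).mul (represents_poly x₁ Q))).2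
      (hle key)
  have h2 : S.val (MvPolynomial.aeval T Q) ≠ 0 := by
    intro h0
    obtain ⟨x, hx, hx'⟩ := ((((hval Q).eq_iff (represents_zero x₁)).1 h0).and (hle ev1)).exists
    exact hx' hx
  have h3 : φ = S.val (MvPolynomial.aeval T N / MvPolynomial.aeval T Q) := by
    rw [map_div₀, eq_div_iff h2, ← hNQ, div_mul_eq_mul_div, div_eq_iff hQ', h1]
  rw [h3]
  exact (MvPolynomial.aeval T N / MvPolynomial.aeval T Q).2

end Rational

end PointInvariants

theorem mainTheorem5 (n : ℕ) (hn : 4 ≤ n) :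
    -- the number of fundamental invariants, for `n ≥ 5` (for `n = 4` there is one, `r_4`)
    (5 ≤ n → Fintype.card (PointInvariants.InvIndex n) = 2 * n - 8) ∧
    -- the `r_j` are cross-ratios of the directions
    (∀ p : (Fin n → ℂ) × (Fin n → ℂ), PointInvariants.GenericElements p →
      ∀ j : ℕ, 4 ≤ j → j ≤ n →
        PointInvariants.r p.1 j =
          ((PointInvariants.entry p.1 3 - PointInvariants.entry p.1 1) *
            (PointInvariants.entry p.1 j - PointInvariants.entry p.1 2)) /
          ((PointInvariants.entry p.1 3 - PointInvariants.entry p.1 2) *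
            (PointInvariants.entry p.1 j - PointInvariants.entry p.1 1))) ∧
    -- the `r_j` and `Ω_l` are invariants
    (∀ k : PointInvariants.InvIndex n,
      PointInvariants.IsInvariantOn (fun p => PointInvariants.fundInv p k)
        {p | PointInvariants.GenericElements p}) ∧
    -- they are functionally independent
    (∀ p : (Fin n → ℂ) × (Fin n → ℂ), PointInvariants.GenericElements p →
      LinearIndependent ℂ (fun k : PointInvariants.InvIndex n =>
        fderiv ℂ (fun q : (Fin n → ℂ) × (Fin n → ℂ) => PointInvariants.fundInv q k) p)) ∧
    -- the functions invariant under the group are the functions of the `r_j` and `Ω_l`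
    (∀ (D : Set ((Fin n → ℂ) × (Fin n → ℂ))), (∀ p ∈ D, PointInvariants.GenericElements p) →
      ∀ f : (Fin n → ℂ) × (Fin n → ℂ) → ℂ,
        PointInvariants.IsInvariantOn f D ↔
          ∃ F : (PointInvariants.InvIndex n → ℂ) → ℂ,
            ∀ p ∈ D, f p = F (PointInvariants.fundInv p)) ∧
    -- the holomorphic solutions of the infinitesimal equations are, locally, the holomorphic
    -- functions of the `r_j` and `Ω_l`
    (∀ (U : Set ((Fin n → ℂ) × (Fin n → ℂ))), IsOpen U →
      (∀ p ∈ U, PointInvariants.GenericElements p) →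
      ∀ f : (Fin n → ℂ) × (Fin n → ℂ) → ℂ, DifferentiableOn ℂ f U →
        ((∀ p ∈ U, PointInvariants.IsInfinitesimallyInvariantAt f p) ↔
          ∀ p ∈ U, ∃ V : Set ((Fin n → ℂ) × (Fin n → ℂ)), IsOpen V ∧ p ∈ V ∧ V ⊆ U ∧
            ∃ W : Set (PointInvariants.InvIndex n → ℂ), IsOpen W ∧
            ∃ F : (PointInvariants.InvIndex n → ℂ) → ℂ, DifferentiableOn ℂ F W ∧
              ∀ q ∈ V, PointInvariants.fundInv q ∈ W ∧
                f q = F (PointInvariants.fundInv q))) ∧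
    -- the rational invariants are the rational functions of the `r_j` and `Ω_l`
    (∀ φ : PointInvariants.RatVW n,
      PointInvariants.IsRationalInvariant φ ↔
        φ ∈ IntermediateField.adjoin ℂ
          (Set.range (PointInvariants.fundInv (PointInvariants.genericPoint n)))) := by
  refine ⟨fun h5 => ?_, fun p hp j hj hjn => PointInvariants.r_eq_crossRatio hn hp.1 hj hjn,
    PointInvariants.fundInv_isInvariantOn hn,
    fun p hp => PointInvariants.linearIndependent_fderiv_fundInv hn hp.nondegenerate,
    fun D hD f => PointInvariants.isInvariantOn_iff hn hD f,
    fun U hU hgen f hf => PointInvariants.isInfinitesimallyInvariantAt_iff_exists hn hU hgen hf,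
    fun φ => ⟨PointInvariants.mem_adjoin_of_isRationalInvariant hn,
      PointInvariants.isRationalInvariant_of_mem_adjoin hn⟩⟩
  rw [Fintype.card_sum, Fintype.card_fin, Fintype.card_fin]
  omega
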